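/- Let $(\mathbb{R},\mathbb{R},\mathcal{L})$ be a cut and project scheme, i.e. let $\mathcal{L}\subset\mathbb{R}\times\mathbb{R}$ be a lattice such that the projection $\pi$ to the first factor is injective on $\mathcal{L}$ and the image of $\mathcal{L}$ under the projection $\pi_{\mathrm{int}}$ to the second factor is dense in $\mathbb{R}$. Put $L=\pi(\mathcal{L})$, and let $\star\colon L\to\mathbb{R}$ be the star map, which sends $x\in L$ to the unique $x^\star\in\mathbb{R}$ with $(x,x^\star)\in\mathcal{L}$. Assume that $\mathcal{L}$ is self-dual, i.e. that $\mathcal{L}=\mathcal{L}^*=\{z\in\mathbb{R}^2 : z\cdot w\in\mathbb{Z}\text{ for all }w\in\mathcal{L}\}$. Let $0\neq g\in\mathcal{S}(\mathbb{R})$ be a Schwartz function with $\widehat{g}=\lambda g$ for some $\lambda\in\mathbb{C}$, where $\widehat{g}(y)=\int_{\mathbb{R}}\mathrm{e}^{-2\pi\mathrm{i}xy}g(x)\,\mathrm{d}x$. Then $\lambda\in\{1,\mathrm{i},-1,-\mathrm{i}\}$. Moreover, the sum in $$\omega_g(\varphi)=\sum_{x\in L}g(x^\star)\,\varphi(x)$$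 converges absolutely for every $\varphi\in C_{\mathsf{c}}(\mathbb{R})$, and $\omega_g=\sum_{x\in L}g(x^\star)\,\delta_x$ is an eigenmeasure of the Fourier transform $\mathcal{F}$ with eigenvalue $\overline{\lambda}$: it is a non-zero Radon measure that defines a tempered distribution, and $\mathcal{F}(\omega_g)=\overline{\lambda}\,\omega_g$ as tempered distributions. It is also an eigenmeasure with eigenvalue $\overline{\lambda}$ in the strict sense, i.e. $\omega_g$ is Fourier transformable as a measure with transform $\nu=\overline{\lambda}\,\omega_g$: for every $f\in C_{\mathsf{c}}(\mathbb{R})$, with $\widetilde{f}(x)=\overline{f(-x)}$ and $\widecheck{f}(y)=\int_{\mathbb{R}}\mathrm{e}^{2\pi\mathrm{i}xy}f(x)\,\mathrm{d}x$, the function $|\widecheck{f}|^2$ is $|\nu|$-integrable and $\omega_g(f*\widetilde{f})=\int_{\mathbb{R}}|\widecheck{f}|^2\,\mathrm{d}\nu$. -/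

import Mathlib

open scoped SchwartzMap CompactlySupported FourierTransform ComplexConjugate
open MeasureTheory

noncomputable section

namespace FourierEigenmeasure

/-! ### Radon measures on the real line -/

/-- A (complex) Radon measure on `ℝ`, viewed as a linear functional on `C_c(ℝ, ℂ)` that is
continuous for the inductive limit topology: for every compact `K` there is a constant `C` with
`|μ(φ)| ≤ C ‖φ‖_∞` for all `φ` supported in `K`. -/
structure IsRadonMeasure (μ : C_c(ℝ, ℂ) → ℂ) : Prop where
  isLinearMap : IsLinearMap ℂ μ
  bounded : ∀ K : Set ℝ, IsCompact K → ∃ C : ℝ, ∀ φ : C_c(ℝ, ℂ), tsupport φ ⊆ K →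
    ∀ M : ℝ, (∀ x, ‖φ x‖ ≤ M) → ‖μ φ‖ ≤ C * M

/-- `μ = u |μ|` is the polar decomposition of the Radon measure `μ`: its total variation is the
positive Borel measure `m`, and `u` is its unimodular density with respect to `m`. Every Radon
measure has such a decomposition; `m` is unique, and `u` is unique up to `m`-null sets. -/
structure IsPolarDecomposition (μ : C_c(ℝ, ℂ) → ℂ) (m : Measure ℝ) (u : ℝ → ℂ) : Prop where
  finite_on_compacts : IsFiniteMeasureOnCompacts m
  measurable_density : Measurable u
  norm_density : ∀ x, ‖u x‖ = 1
  apply_eq : ∀ φ : C_c(ℝ, ℂ), μ φ = ∫ x, φ x * u x ∂m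

/-! ### Fourier transform in the sense of tempered distributions -/

/-- The distribution defined by the measure `μ` is the tempered distribution `T`: they agree on
`C_c^∞(ℝ)`, that is, on the functions that are both Schwartz functions and of compact support. -/
def Represents (T : 𝓢'(ℝ, ℂ)) (μ : C_c(ℝ, ℂ) → ℂ) : Prop :=
  ∀ (f : 𝓢(ℝ, ℂ)) (φ : C_c(ℝ, ℂ)), (∀ x, f x = φ x) → T f = μ φ

/-- `μ` is a tempered Radon measure. -/
def IsTemperedMeasure (μ : C_c(ℝ, ℂ) → ℂ) : Prop :=
  IsRadonMeasure μ ∧ ∃ T : 𝓢'(ℝ, ℂ), Represents T μ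

/-- The tempered measure `μ` is Fourier transformable as a tempered distribution, and its
transform is the Radon measure `ν`. -/
def HasFourierTransform (μ ν : C_c(ℝ, ℂ) → ℂ) : Prop :=
  IsRadonMeasure μ ∧ IsRadonMeasure ν ∧
    ∃ T : 𝓢'(ℝ, ℂ), Represents T μ ∧ Represents (𝓕 T) ν

/-- `μ` is an eigenmeasure of the Fourier transform with eigenvalue `lam`. -/
def IsEigenmeasure (μ : C_c(ℝ, ℂ) → ℂ) (lam : ℂ) : Prop :=
  IsTemperedMeasure μ ∧ μ ≠ 0 ∧ HasFourierTransform μ (lam • μ)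

/-! ### Fourier transform in the strict sense (of measures) -/

/-- The function `f~(x) = conj (f (-x))`. -/
def tilde (f : C_c(ℝ, ℂ)) : C_c(ℝ, ℂ) where
  toFun x := conj (f (-x))
  continuous_toFun := by fun_prop
  hasCompactSupport' :=
    (f.hasCompactSupport.comp_homeomorph (Homeomorph.neg ℝ)).comp_left (g := conj) (map_zero _)

/-- The convolution `(f * h)(x) = ∫ f(t) h(x - t) dt` of two functions in `C_c(ℝ, ℂ)`. -/
def conv (f h : C_c(ℝ, ℂ)) : C_c(ℝ, ℂ) where
  toFun x := ∫ t, f t * h (x - t)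
  continuous_toFun :=
    h.hasCompactSupport.continuous_convolution_right (ContinuousLinearMap.mul ℂ ℂ)
      (f.continuous.locallyIntegrable (μ := volume)) h.continuous
  hasCompactSupport' :=
    HasCompactSupport.convolution (μ := volume) (ContinuousLinearMap.mul ℂ ℂ)
      f.hasCompactSupport h.hasCompactSupport

/-- The Radon measure `μ` is Fourier transformable in the strict sense, with transform the Radon
measure `ν`: for every `f ∈ C_c(ℝ, ℂ)`, with inverse Fourier transform `f^∨`, the function
`|f^∨|²` is integrable with respect to (the total variation of) `ν`, and
`μ(f * f~) = ∫ |f^∨|² dν`. -/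
def HasStrictFourierTransform (μ ν : C_c(ℝ, ℂ) → ℂ) : Prop :=
  IsRadonMeasure μ ∧ IsRadonMeasure ν ∧
    ∃ (m : Measure ℝ) (u : ℝ → ℂ), IsPolarDecomposition ν m u ∧
      ∀ f : C_c(ℝ, ℂ),
        Integrable (fun y => ‖𝓕⁻ (f : ℝ → ℂ) y‖ ^ 2) m ∧
        μ (conv f (tilde f)) = ∫ y, ((‖𝓕⁻ (f : ℝ → ℂ) y‖ ^ 2 : ℝ) : ℂ) * u y ∂m

/-- `μ` is a strict eigenmeasure of the Fourier transform with eigenvalue `lam`. -/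
def IsStrictEigenmeasure (μ : C_c(ℝ, ℂ) → ℂ) (lam : ℂ) : Prop :=
  IsEigenmeasure μ lam ∧ HasStrictFourierTransform μ (lam • μ)

/-! ### Cut and project schemes with physical space `ℝ` and internal space `ℝ` -/

/-- `(ℝ, ℝ, 𝓛)` is a cut and project scheme: `𝓛` is a lattice in `ℝ × ℝ` (a discrete subgroup that
spans), the projection to the first factor (physical space) is injective on `𝓛`, and the
projection of `𝓛` to the second factor (internal space) is dense. -/
structure IsCutAndProjectScheme (𝓛 : Submodule ℤ (ℝ × ℝ)) : Prop where
  discrete : DiscreteTopology 𝓛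
  isZLattice : IsZLattice ℝ 𝓛
  injOn_fst : Set.InjOn Prod.fst (𝓛 : Set (ℝ × ℝ))
  dense_snd : Dense (Prod.snd '' (𝓛 : Set (ℝ × ℝ)))

/-- The dual lattice `𝓛* = {z : z · w ∈ ℤ for all w ∈ 𝓛}`, for the Euclidean inner product. -/
def dualLattice (𝓛 : Submodule ℤ (ℝ × ℝ)) : Set (ℝ × ℝ) :=
  {z | ∀ w ∈ 𝓛, ∃ n : ℤ, z.1 * w.1 + z.2 * w.2 = n}

/-- The projection `L` of the lattice `𝓛` to the physical space. -/
def projL (𝓛 : Submodule ℤ (ℝ × ℝ)) : Set ℝ :=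
  Prod.fst '' (𝓛 : Set (ℝ × ℝ))

/-- The star map: `x ∈ L` is lifted to the point of `𝓛` above it, which is then projected to the
internal space (the value outside `L` is irrelevant). -/
def starMap (𝓛 : Submodule ℤ (ℝ × ℝ)) (x : ℝ) : ℝ :=
  (Function.invFunOn Prod.fst (𝓛 : Set (ℝ × ℝ)) x).2

/-- The weighted Dirac comb `ω_g = ∑_{x ∈ L} g(x^⋆) δ_x`, as a functional on `C_c(ℝ, ℂ)`. -/
def weightedComb (𝓛 : Submodule ℤ (ℝ × ℝ)) (g : 𝓢(ℝ, ℂ)) (φ : C_c(ℝ, ℂ)) : ℂ :=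
  ∑' x : projL 𝓛, g (starMap 𝓛 x) * φ x

end FourierEigenmeasure

end

/-! Everything rests on Poisson summation over `𝓛`. A self-dual lattice has covolume 1, so Poisson
summation for ℤ², transported by a matrix of determinant ±1, equates the sum of φ(x)ψ(x⋆) over `𝓛`
with the sum of the Fourier transforms at the same points (`tsum_lattice_eq_tsum_fourier`). Taking ψ
= g with ĝ = λg turns this into a statement about ω_g alone: ω_g(f̂) = λ⁻¹ω_g(f). Since the inverse
transform is the transform followed by a reflection, g(x) = λ²g(-x); hence λ⁴ = 1 and λ⁻¹ is the
conjugate of λ.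

Convergence comes from a planar count: a product of one-variable functions of decay |x|⁻³ is
O(‖z‖⁻³), which is summable over a lattice of rank 2. The comb is non-zero because shrinking tents
recover each weight g(x⋆), and the points x⋆ are dense.

The strict statement is the harder one. For φ = f * f~ the transform |f̂|² need not decay fast, so
the summability of |f^∨(x)|²|g(x⋆)|, needed both for integrability and for Poisson summation,
requires a separate argument. It is a Bessel inequality (`summable_sq_fourierInv`), proved by
duality: exponential sums with frequencies x are almost orthogonal in a Gaussian-weighted L², once
coefficients carry weights decaying in x⋆ (`integral_gaussian_mul_sq_le`, `schur_bound`). -/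

/-! ### Poisson summation for `ℤᵈ ⊂ ℝᵈ` -/

namespace UnitAddTorus

variable {d : Type*}

/-- The coordinatewise quotient map `ℝᵈ → (ℝ/ℤ)ᵈ`. -/
def proj (x : d → ℝ) : UnitAddTorus d := fun i => (x i : UnitAddCircle)

/-- An integer vector as a real vector. -/
def intVec (n : d → ℤ) : d → ℝ := fun i => (n i : ℝ)

/-- Lets a continuous ℤᵈ-periodic function descend to a continuous function on the torus. -/
theorem isQuotientMap_proj : Topology.IsQuotientMap (proj (d := d)) :=
  (IsOpenQuotientMap.piMap (f := fun (_ : d) (x : ℝ) => (x : UnitAddCircle))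
    fun _ => QuotientAddGroup.isOpenQuotientMap_mk).isQuotientMap

theorem proj_add_intVec (x : d → ℝ) (n : d → ℤ) : proj (x + intVec n) = proj x := by
  funext i
  simp [proj, intVec]

theorem exists_eq_add_intVec {x y : d → ℝ} (h : proj x = proj y) : ∃ n, y = x + intVec n := by
  have (i : d) : ∃ n : ℤ, y i = x i + n := by
    have hi : ((y i - x i : ℝ) : UnitAddCircle) = 0 := by
      rw [AddCircle.coe_sub, sub_eq_zero]
      exact (congrFun h i).symm
    obtain ⟨n, hn⟩ := (AddCircle.coe_eq_zero_iff 1).1 hi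
    exact ⟨n, by simp at hn; linarith⟩
  choose n hn using this
  exact ⟨n, funext hn⟩

/-- The half-open unit cube with corner `n`. -/
def cube (n : d → ℤ) : Set (d → ℝ) := {x | ∀ i, x i ∈ Set.Ioc (n i : ℝ) (n i + 1)}

/-- Ceilings index the cubes, which reduces disjointness and covering to integer arithmetic. The
cube at 0 is the domain of integration in `mFourierCoeff_eq_integral`. -/
theorem mem_cube_iff {n : d → ℤ} {x : d → ℝ} : x ∈ cube n ↔ ∀ i, ⌈x i⌉ = n i + 1 := by
  simp [cube, Int.ceil_eq_iff]

theorem pairwise_disjoint_cube : Pairwise (Function.onFun Disjoint (cube (d := d))) := by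
  intro m n hmn
  refine Set.disjoint_left.2 fun x hm hn => hmn (funext fun i => ?_)
  have h1 := mem_cube_iff.1 hm i
  have h2 := mem_cube_iff.1 hn i
  omega

theorem iUnion_cube : ⋃ n, cube (d := d) n = Set.univ := by
  refine Set.eq_univ_of_forall fun x => Set.mem_iUnion.2 ⟨fun i => ⌈x i⌉ - 1, ?_⟩
  simp [mem_cube_iff]

variable [Fintype d]

theorem measurableSet_cube (n : d → ℤ) : MeasurableSet (cube n) :=
  MeasurableSet.univ_pi' fun _ => measurableSet_Ioc

theorem norm_le_one_of_mem_cube {x : d → ℝ} (hx : x ∈ cube (0 : d → ℤ)) : ‖x‖ ≤ 1 := by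
  refine (pi_norm_le_iff_of_nonneg zero_le_one).2 fun i => ?_
  have := hx i
  simp only [Pi.zero_apply, Int.cast_zero, zero_add, Set.mem_Ioc] at this
  rw [Real.norm_eq_abs, abs_le]
  constructor <;> linarith

theorem volume_cube_zero : volume (cube (0 : d → ℤ)) = 1 := by
  have : cube (0 : d → ℤ) = Set.univ.pi fun _ => Set.Ioc (0 : ℝ) 1 := by
    ext x; simp [cube]
  rw [this, Real.volume_pi_Ioc]
  simp

theorem setIntegral_cube (f : (d → ℝ) → ℂ) (n : d → ℤ) :
    ∫ x in cube n, f x = ∫ x in cube (0 : d → ℤ), f (x + intVec n) := by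
  rw [← (measurePreserving_add_right volume (intVec n)).setIntegral_preimage_emb
    (measurableEmbedding_addRight _) f (cube n)]
  congr 2
  ext x
  simp only [cube, intVec, Set.mem_Ioc, Set.mem_ofPred_eq, Set.mem_preimage, Pi.add_apply,
    Pi.zero_apply, Int.cast_zero]
  refine forall_congr' fun i => ?_
  constructor <;> rintro ⟨h1, h2⟩ <;> constructor <;> linarith

theorem hasSum_integral_cube {f : (d → ℝ) → ℂ} (hf : Integrable f) :
    HasSum (fun n : d → ℤ => ∫ x in cube (0 : d → ℤ), f (x + intVec n)) (∫ x, f x) := by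
  have := hasSum_integral_iUnion (f := f) (μ := volume) (measurableSet_cube (d := d))
    pairwise_disjoint_cube (by rw [iUnion_cube]; exact hf.integrableOn)
  rw [iUnion_cube, setIntegral_univ] at this
  exact (funext fun n => setIntegral_cube f n) ▸ this

/-- **Poisson summation** for `ℤᵈ ⊂ ℝᵈ`, for an integrable continuous function whose translates
are locally uniformly summable and whose Fourier transform is summable. -/
theorem tsum_eq_tsum_integral {Φ : (d → ℝ) → ℂ} (hc : Continuous Φ) (hi : Integrable Φ)
    (hb : ∀ R : ℝ, ∃ u : (d → ℤ) → ℝ, Summable u ∧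
      ∀ x, ‖x‖ ≤ R → ∀ n, ‖Φ (x + intVec n)‖ ≤ u n)
    (hs : Summable fun k : d → ℤ => ∫ x, mFourier (-k) (proj x) * Φ x) :
    ∑' n : d → ℤ, Φ (intVec n) = ∑' k : d → ℤ, ∫ x, mFourier (-k) (proj x) * Φ x := by
  -- The periodization of `Φ`; it will be expanded in a Fourier series on the torus and evaluated at
  -- 0.
  set P : (d → ℝ) → ℂ := fun x => ∑' n : d → ℤ, Φ (x + intVec n) with hP
  have hPc : Continuous P := by
    refine continuous_iff_continuousAt.2 fun x => ?_
    obtain ⟨u, hu, hub⟩ := hb (‖x‖ + 1)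
    have : ContinuousOn P (Metric.ball 0 (‖x‖ + 1)) :=
      continuousOn_tsum (fun n => (hc.comp (continuous_id.add continuous_const)).continuousOn) hu
        fun n y hy => hub y (by simpa using (Metric.mem_ball.1 hy).le) n
    exact this.continuousAt (Metric.isOpen_ball.mem_nhds (by simp))
  have hPadd (x : d → ℝ) (m : d → ℤ) : P (x + intVec m) = P x := by
    refine Eq.trans (tsum_congr fun n => congrArg Φ ?_)
      (Equiv.tsum_eq (Equiv.addLeft m) fun n => Φ (x + intVec n))
    ext i
    simp [intVec, add_assoc]
  have hfac (x y : d → ℝ) (h : proj x = proj y) : P x = P y := by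
    obtain ⟨n, rfl⟩ := exists_eq_add_intVec h
    exact (hPadd x n).symm
  let F : C(UnitAddTorus d, ℂ) :=
    Topology.IsQuotientMap.lift (f := ⟨proj, isQuotientMap_proj.continuous⟩)
      isQuotientMap_proj ⟨P, hPc⟩ fun x y h => hfac x y h
  have hF (x : d → ℝ) : F (proj x) = P x :=
    ContinuousMap.congr_fun (Topology.IsQuotientMap.lift_comp
      (f := ⟨proj, isQuotientMap_proj.continuous⟩)
      isQuotientMap_proj ⟨P, hPc⟩ fun x y h => hfac x y h) x
  have hmc (k : d → ℤ) : Continuous fun x : d → ℝ => mFourier k (proj x) :=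
    (mFourier k).continuous.comp isQuotientMap_proj.continuous
  have hmn (k : d → ℤ) (y : UnitAddTorus d) : ‖mFourier k y‖ ≤ 1 :=
    ((mFourier k).norm_coe_le_norm y).trans_eq mFourier_norm
  -- Unfolding: the characters are periodic, so integrating the periodization over one cube is
  -- integrating `Φ` over the whole space.
  have hcoeff (k : d → ℤ) : mFourierCoeff F k = ∫ x, mFourier (-k) (proj x) * Φ x := by
    have hint : Integrable fun x => mFourier (-k) (proj x) * Φ x :=
      hi.bdd_mul (hmc _).aestronglyMeasurable (Filter.Eventually.of_forall fun x => hmn _ _)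
    rw [mFourierCoeff_eq_integral F k 0, ← (hasSum_integral_cube hint).tsum_eq]
    obtain ⟨u, hu, hub⟩ := hb 1
    have hset : {x : d → ℝ | ∀ i, x i ∈ Set.Ioc ((0 : d → ℝ) i) ((0 : d → ℝ) i + 1)}
        = cube (0 : d → ℤ) := by
      ext x; simp [cube]
    rw [hset]
    have hbd (n : d → ℤ) : ∀ x ∈ cube (0 : d → ℤ),
        ‖mFourier (-k) (proj (x + intVec n)) * Φ (x + intVec n)‖ ≤ u n := by
      intro x hx
      rw [norm_mul]
      exact (mul_le_of_le_one_left (norm_nonneg _) (hmn _ _)).trans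
        (hub x (norm_le_one_of_mem_cube hx) n)
    have hfin : volume (cube (0 : d → ℤ)) < ⊤ := by simp [volume_cube_zero]
    rw [integral_tsum_of_summable_integral_norm]
    · refine setIntegral_congr_fun (measurableSet_cube 0) fun x _ => ?_
      change mFourier (-k) (proj x) • F (proj x) = _
      rw [hF, smul_eq_mul, hP, ← tsum_mul_left]
      simp only [proj_add_intVec]
    · intro n
      exact (hint.comp_add_right (intVec n)).integrableOn
    · refine Summable.of_nonneg_of_le (fun n => integral_nonneg fun x => norm_nonneg _)
        (fun n => ?_) hu
      have := norm_setIntegral_le_of_norm_le_const (μ := volume) hfin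
        (f := fun x => ‖mFourier (-k) (proj (x + intVec n)) * Φ (x + intVec n)‖) (C := u n)
        (fun x hx => by simpa using hbd n x hx)
      rw [Measure.real, volume_cube_zero, ENNReal.toReal_one, mul_one] at this
      exact (le_abs_self _).trans this
  have hsum : Summable (mFourierCoeff F) := by
    rw [funext hcoeff]; exact hs
  have h0 := (hasSum_mFourier_series_apply_of_summable hsum (proj 0)).tsum_eq
  rw [hF] at h0
  have h1 (k : d → ℤ) : mFourier k (proj (0 : d → ℝ)) = 1 := by
    simp [mFourier, proj]
  simp only [h1, hcoeff, smul_eq_mul, mul_one] at h0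
  rw [h0, hP]
  simp

end UnitAddTorus

namespace FourierEigenmeasure

/-! ### Summation over a planar lattice -/

/-- The function `(1 + t)⁻³`. -/
noncomputable def cubicDecay (t : ℝ) : ℝ := ((1 + t) ^ 3)⁻¹

/-- `f` decays at least like `|x|⁻³` at infinity and is bounded. -/
def HasCubicDecay (f : ℝ → ℂ) : Prop := ∃ C : ℝ, ∀ x, ‖f x‖ ≤ C * cubicDecay |x|

theorem cubicDecay_nonneg {t : ℝ} (ht : 0 ≤ t) : 0 ≤ cubicDecay t := by
  unfold cubicDecay; positivity

theorem cubicDecay_mul_le {s t r C : ℝ} (hr : 0 ≤ r) (hC : 0 < C)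
    (h : C * (1 + r) ≤ (1 + s) * (1 + t)) :
    cubicDecay s * cubicDecay t ≤ (C ^ 3)⁻¹ * cubicDecay r := by
  unfold cubicDecay
  rw [← mul_inv, ← mul_inv, ← mul_pow, ← mul_pow]
  gcongr

/-- Since (1 + |z₁|)(1 + |z₂|) ≥ 1 + max(|z₁|, |z₂|) and the norm on `ℝ × ℝ` is the maximum. -/
theorem cubicDecay_mul_le_norm (z : ℝ × ℝ) :
    cubicDecay |z.1| * cubicDecay |z.2| ≤ cubicDecay ‖z‖ := by
  have h := cubicDecay_mul_le (s := |z.1|) (t := |z.2|) (norm_nonneg z) one_pos (by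
    rw [Prod.norm_def, Real.norm_eq_abs, Real.norm_eq_abs, one_mul]
    have h1 := abs_nonneg z.1
    have h2 := abs_nonneg z.2
    rcases max_cases |z.1| |z.2| with ⟨h, _⟩ | ⟨h, _⟩ <;> rw [h] <;> nlinarith)
  simpa using h

/-- Makes lattice sums converge uniformly over bounded translates, as the periodization requires. -/
theorem cubicDecay_norm_add_le (z y : ℝ × ℝ) {S : ℝ} (hy : ‖y‖ ≤ S) :
    cubicDecay ‖y + z‖ ≤ (1 + S) ^ 3 * cubicDecay ‖z‖ := by
  unfold cubicDecay
  have hS : 0 ≤ S := (norm_nonneg y).trans hy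
  rw [inv_le_iff_one_le_mul₀ (by positivity), mul_comm, ← mul_assoc,
    ← div_eq_mul_inv, one_le_div (by positivity), ← mul_pow]
  gcongr
  have : ‖z‖ ≤ ‖y + z‖ + ‖y‖ := by simpa using norm_sub_le (y + z) y
  nlinarith [norm_nonneg (y + z)]

theorem HasCubicDecay.exists_mul_le {φ ψ : ℝ → ℂ} (hφ : HasCubicDecay φ) (hψ : HasCubicDecay ψ) :
    ∃ C : ℝ, 0 ≤ C ∧ ∀ z : ℝ × ℝ, ‖φ z.1 * ψ z.2‖ ≤ C * cubicDecay ‖z‖ := by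
  obtain ⟨C, hC⟩ := hφ
  obtain ⟨D, hD⟩ := hψ
  have hC0 : 0 ≤ C := by simpa [cubicDecay] using (norm_nonneg _).trans (hC 0)
  have hD0 : 0 ≤ D := by simpa [cubicDecay] using (norm_nonneg _).trans (hD 0)
  refine ⟨C * D, mul_nonneg hC0 hD0, fun z => ?_⟩
  rw [norm_mul]
  calc ‖φ z.1‖ * ‖ψ z.2‖ ≤ (C * cubicDecay |z.1|) * (D * cubicDecay |z.2|) :=
        mul_le_mul (hC _) (hD _) (norm_nonneg _)
          (mul_nonneg hC0 (cubicDecay_nonneg (abs_nonneg _)))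
    _ = C * D * (cubicDecay |z.1| * cubicDecay |z.2|) := by ring
    _ ≤ _ := mul_le_mul_of_nonneg_left (cubicDecay_mul_le_norm z) (mul_nonneg hC0 hD0)

theorem HasCubicDecay.integrable {f : ℝ → ℂ} (hf : HasCubicDecay f) (hc : Continuous f) :
    Integrable f := by
  obtain ⟨C, hC⟩ := hf
  have h := (integrable_one_add_norm (E := ℝ) (μ := volume) (r := 3) (by simp)).const_mul C
  refine h.mono' hc.aestronglyMeasurable (Filter.Eventually.of_forall fun x => ?_)
  refine (hC x).trans_eq ?_
  rw [cubicDecay, Real.norm_eq_abs, Real.rpow_neg (by positivity)]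
  norm_cast

theorem HasCubicDecay.of_compactlySupported (f : C_c(ℝ, ℂ)) : HasCubicDecay f := by
  obtain ⟨C, hC⟩ := (f.hasCompactSupport.mul_right (f' := fun x : ℝ => ((1 + |x| : ℝ) : ℂ) ^ 3)
    ).exists_bound_of_continuous (by fun_prop)
  refine ⟨C, fun x => ?_⟩
  have : ‖f x * ((1 + |x| : ℝ) : ℂ) ^ 3‖ ≤ C := hC x
  rw [norm_mul, norm_pow, Complex.norm_real, Real.norm_of_nonneg (by positivity)] at this
  rw [cubicDecay, ← div_eq_mul_inv, le_div_iff₀ (by positivity)]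
  exact this

theorem exists_seminorm_cubicDecay : ∃ s : Finset (ℕ × ℕ), ∃ C : ℝ, 0 ≤ C ∧
    ∀ (f : 𝓢(ℝ, ℂ)) (x : ℝ),
      ‖f x‖ ≤ C * (s.sup (schwartzSeminormFamily ℂ ℝ ℂ)) f * cubicDecay |x| := by
  refine ⟨Finset.Iic (3, 0), 2 ^ 3, by positivity, fun f x => ?_⟩
  have := SchwartzMap.one_add_le_sup_seminorm_apply (𝕜 := ℂ) (m := (3, 0)) le_rfl le_rfl f x
  rw [norm_iteratedFDeriv_zero, Real.norm_eq_abs] at this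
  rw [cubicDecay, ← div_eq_mul_inv, le_div_iff₀ (by positivity), mul_comm]
  exact this

theorem HasCubicDecay.of_schwartz (f : 𝓢(ℝ, ℂ)) : HasCubicDecay f := by
  obtain ⟨s, C, -, h⟩ := exists_seminorm_cubicDecay
  exact ⟨_, h f⟩

section Lattice

variable (𝓛 : Submodule ℤ (ℝ × ℝ)) [DiscreteTopology 𝓛] [IsZLattice ℝ 𝓛]

theorem finrank_planar_lattice : Module.finrank ℤ 𝓛 = 2 := by
  rw [ZLattice.rank ℝ 𝓛]; simp

theorem summable_cubicDecay : Summable fun z : 𝓛 => cubicDecay ‖(z : ℝ × ℝ)‖ := by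
  have h := ZLattice.summable_norm_pow_inv 𝓛 3 (by rw [finrank_planar_lattice]; norm_num)
  refine Summable.of_norm_bounded_eventually h ?_
  -- At `z = 0` the inverse power is 0 by convention while `cubicDecay 0 = 1`, so this one point is
  -- excepted.
  refine (Set.finite_singleton (0 : 𝓛)).subset fun z hz => ?_
  by_contra h0
  refine hz ?_
  have hz0 : 0 < ‖z‖ := norm_pos_iff.2 h0
  change ‖cubicDecay ‖z‖‖ ≤ _
  rw [Real.norm_of_nonneg (cubicDecay_nonneg (norm_nonneg _)), cubicDecay, inv_pow]
  gcongr
  linarith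

variable {𝓛}

theorem HasCubicDecay.summable_mul {φ ψ : ℝ → ℂ} (hφ : HasCubicDecay φ) (hψ : HasCubicDecay ψ) :
    Summable fun z : 𝓛 => φ (z : ℝ × ℝ).1 * ψ (z : ℝ × ℝ).2 := by
  obtain ⟨C, -, hC⟩ := hφ.exists_mul_le hψ
  exact Summable.of_norm_bounded ((summable_cubicDecay 𝓛).mul_left C) fun z => hC z

/-! ### Poisson summation for a self-dual lattice -/

/-- A self-dual lattice has a basis `(a, c)`, `(b, d)` with `ad - bc = ±1`. -/
theorem exists_unimodular_basis (hdual : dualLattice 𝓛 = (𝓛 : Set (ℝ × ℝ))) :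
    ∃ (a b c d : ℝ), (a * d - b * c) ^ 2 = 1 ∧
      (∃ e : (Fin 2 → ℤ) ≃ 𝓛, ∀ n, (e n : ℝ × ℝ) = (a * n 0 + b * n 1, c * n 0 + d * n 1)) ∧
      ∃ e : (Fin 2 → ℤ) ≃ 𝓛, ∀ n, (n 0 : ℝ) = a * (e n : ℝ × ℝ).1 + c * (e n : ℝ × ℝ).2 ∧
        (n 1 : ℝ) = b * (e n : ℝ × ℝ).1 + d * (e n : ℝ × ℝ).2 := by
  have : Module.Finite ℤ 𝓛 := ZLattice.module_finite ℝ 𝓛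
  have : Module.Free ℤ 𝓛 := ZLattice.module_free ℝ 𝓛
  let B := Module.finBasisOfFinrankEq ℤ 𝓛 (finrank_planar_lattice 𝓛)
  obtain ⟨⟨a, c⟩, hB0⟩ : ∃ p : ℝ × ℝ, (B 0 : ℝ × ℝ) = p := ⟨_, rfl⟩
  obtain ⟨⟨b, d⟩, hB1⟩ : ∃ p : ℝ × ℝ, (B 1 : ℝ × ℝ) = p := ⟨_, rfl⟩
  have hcoe (n : Fin 2 → ℤ) :
      (B.equivFun.symm n : ℝ × ℝ) = (a * n 0 + b * n 1, c * n 0 + d * n 1) := by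
    rw [Module.Basis.equivFun_symm_apply, Fin.sum_univ_two, Submodule.coe_add,
      Submodule.coe_smul, Submodule.coe_smul, hB0, hB1]
    ext <;> simp [mul_comm]
  have hmem {z : ℝ × ℝ} : z ∈ 𝓛 ↔ ∀ w ∈ 𝓛, ∃ n : ℤ, z.1 * w.1 + z.2 * w.2 = n := by
    rw [← SetLike.mem_coe, ← hdual]; rfl
  have hb0 : (a, c) ∈ 𝓛 := hB0 ▸ (B 0).2
  have hb1 : (b, d) ∈ 𝓛 := hB1 ▸ (B 1).2
  -- If the determinant vanished, the adjugate would give real linear relations between the basis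
  -- vectors, forcing every entry to be 0.
  have hD : a * d - b * c ≠ 0 := by
    intro h0
    have hli := (B.ofZLatticeBasis ℝ 𝓛).linearIndependent
    rw [Fintype.linearIndependent_iff] at hli
    have key (s t : ℝ) (h1 : s * a + t * b = 0) (h2 : s * c + t * d = 0) : s = 0 ∧ t = 0 := by
      have := hli ![s, t] (by
        simp only [Fin.sum_univ_two, Module.Basis.ofZLatticeBasis_apply, hB0, hB1]
        ext <;> simp [h1, h2])
      exact ⟨this 0, this 1⟩
    have h1 := key d (-c) (by linarith) (by ring)
    have h2 := key b (-a) (by ring) (by linarith)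
    have := key 1 0 (by linarith [h2.2]) (by linarith [h1.2])
    exact one_ne_zero this.1
  set D := a * d - b * c with hDdef
  -- The vector whose inner products with (a, c) and (b, d) are `k 0` and `k 1`. It lies in the dual
  -- lattice, hence in `𝓛`.
  have hw (k : Fin 2 → ℤ) : ((d * k 0 - c * k 1) / D, (a * k 1 - b * k 0) / D) ∈ 𝓛 := by
    refine hmem.2 fun w hw => ?_
    obtain ⟨n, hn⟩ : ∃ n, w = (a * ((n : Fin 2 → ℤ) 0) + b * n 1, c * n 0 + d * n 1) :=
      ⟨B.equivFun ⟨w, hw⟩, by rw [← hcoe]; simp⟩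
    refine ⟨k 0 * n 0 + k 1 * n 1, ?_⟩
    rw [hn]
    push_cast
    field_simp
    rw [hDdef]
    ring
  let E (k : Fin 2 → ℤ) : 𝓛 := ⟨((d * k 0 - c * k 1) / D, (a * k 1 - b * k 0) / D), hw k⟩
  have hE (k : Fin 2 → ℤ) : (E k : ℝ × ℝ) = ((d * k 0 - c * k 1) / D, (a * k 1 - b * k 0) / D) :=
    rfl
  have hEbij : Function.Bijective E := by
    refine ⟨fun k l hkl => ?_, fun z => ?_⟩
    · have hkl' := congrArg (Subtype.val) hkl
      rw [hE, hE, Prod.mk.injEq] at hkl'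
      obtain ⟨h1, h2⟩ := hkl'
      rw [div_left_inj' hD] at h1 h2
      have e0 : D * (k 0 : ℝ) = D * l 0 := by rw [hDdef]; linear_combination a * h1 + c * h2
      have e1 : D * (k 1 : ℝ) = D * l 1 := by rw [hDdef]; linear_combination b * h1 + d * h2
      have e0' := mul_left_cancel₀ hD e0
      have e1' := mul_left_cancel₀ hD e1
      ext i
      fin_cases i
      · exact_mod_cast e0'
      · exact_mod_cast e1'
    · obtain ⟨p, hp⟩ := hmem.1 z.2 _ hb0
      obtain ⟨q, hq⟩ := hmem.1 z.2 _ hb1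
      refine ⟨![p, q], Subtype.ext (Prod.ext ?_ ?_)⟩
      · simp [hE, ← hp, ← hq]
        field_simp
        rw [hDdef]
        ring
      · simp [hE, ← hp, ← hq]
        field_simp
        rw [hDdef]
        ring
  refine ⟨a, b, c, d, ?_, ⟨B.equivFun.symm.toEquiv, hcoe⟩,
    Equiv.ofBijective E hEbij, fun n => ?_⟩
  -- The squared determinant of two lattice vectors is their Gram determinant, an integer by
  -- self-duality. For the basis it is D², for the dual basis D⁻²; both being integers, D² = 1.
  · have gram (u v : ℝ × ℝ) (hu : u ∈ 𝓛) (hv : v ∈ 𝓛) :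
        ∃ N : ℤ, (u.1 * v.2 - v.1 * u.2) ^ 2 = N := by
      obtain ⟨p, hp⟩ := hmem.1 hu u hu
      obtain ⟨q, hq⟩ := hmem.1 hu v hv
      obtain ⟨r, hr⟩ := hmem.1 hv v hv
      refine ⟨p * r - q ^ 2, ?_⟩
      push_cast
      rw [← hp, ← hq, ← hr]
      ring
    obtain ⟨N, hN⟩ := gram _ _ hb0 hb1
    obtain ⟨M, hM⟩ := gram _ _ (hw ![1, 0]) (hw ![0, 1])
    have hM' : 1 / D ^ 2 = M := by
      rw [← hM]
      simp
      field_simp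
      rw [hDdef]
      ring
    have hN' : D ^ 2 = N := by rw [← hN]
    have hNM : N * M = 1 := by
      have : (N : ℝ) * M = 1 := by rw [← hM', ← hN']; field_simp
      exact_mod_cast this
    have hN0 : 0 ≤ N := by
      have : (0 : ℝ) ≤ N := by rw [← hN']; positivity
      exact_mod_cast this
    rw [hN', Int.eq_one_of_mul_eq_one_right hN0 hNM]
    simp
  · simp only [Equiv.ofBijective_apply, hE]
    constructor <;> field_simp <;> rw [hDdef] <;> ring

theorem measurePreserving_planar_unimodular {a b c d : ℝ} (h : (a * d - b * c) ^ 2 = 1) :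
    MeasurePreserving fun x : Fin 2 → ℝ => (a * x 0 + b * x 1, c * x 0 + d * x 1) := by
  have hM : (!![a, b; c, d] : Matrix (Fin 2) (Fin 2) ℝ).det = a * d - b * c :=
    Matrix.det_fin_two_of a b c d
  have h1 : MeasurePreserving (Matrix.toLin' (!![a, b; c, d] : Matrix (Fin 2) (Fin 2) ℝ)) := by
    refine ⟨(LinearMap.continuous_of_finiteDimensional _).measurable, ?_⟩
    have h0 : a * d - b * c ≠ 0 := by
      rintro h0
      simp [h0] at h
    rw [Real.map_matrix_volume_pi_eq_smul_volume_pi (by rwa [hM]), hM, abs_inv,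
      (pow_eq_one_iff_of_nonneg (abs_nonneg _) two_ne_zero).1 ((sq_abs _).trans h)]
    simp
  have h2 := (volume_preserving_finTwoArrow ℝ).comp h1
  have h3 : (MeasurableEquiv.finTwoArrow : (Fin 2 → ℝ) ≃ᵐ ℝ × ℝ) ∘
      (Matrix.toLin' (!![a, b; c, d] : Matrix (Fin 2) (Fin 2) ℝ)) =
        fun x : Fin 2 → ℝ => (a * x 0 + b * x 1, c * x 0 + d * x 1) := by
    funext x
    simp [MeasurableEquiv.finTwoArrow, Matrix.mulVec, dotProduct]
  rwa [h3] at h2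

theorem continuous_exp_mul {f : ℝ → ℂ} (hf : Continuous f) (w : ℝ) :
    Continuous fun v : ℝ => Complex.exp ((-2 * Real.pi * (w * v) : ℝ) * Complex.I) * f v := by
  fun_prop

/-- **Poisson summation** over a self-dual planar lattice, for products of functions of one
variable. -/
theorem tsum_lattice_eq_tsum_fourier (hdual : dualLattice 𝓛 = (𝓛 : Set (ℝ × ℝ)))
    {φ ψ : ℝ → ℂ} (hφ : HasCubicDecay φ) (hψ : HasCubicDecay ψ)
    (hφc : Continuous φ) (hψc : Continuous ψ)
    (hs : Summable fun z : 𝓛 => 𝓕 φ (z : ℝ × ℝ).1 * 𝓕 ψ (z : ℝ × ℝ).2) :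
    ∑' z : 𝓛, φ (z : ℝ × ℝ).1 * ψ (z : ℝ × ℝ).2 =
      ∑' z : 𝓛, 𝓕 φ (z : ℝ × ℝ).1 * 𝓕 ψ (z : ℝ × ℝ).2 := by
  obtain ⟨a, b, c, d, hD, ⟨e, he⟩, e', he'⟩ := exists_unimodular_basis hdual
  set A : (Fin 2 → ℝ) → ℝ × ℝ := fun x => (a * x 0 + b * x 1, c * x 0 + d * x 1) with hA
  have hAmp : MeasurePreserving A := measurePreserving_planar_unimodular hD
  have hAc : Continuous A := by fun_prop
  have hAe (x : Fin 2 → ℝ) (n : Fin 2 → ℤ) : A (x + UnitAddTorus.intVec n) = A x + e n := by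
    rw [he]
    ext <;> simp [hA, UnitAddTorus.intVec] <;> ring
  have hA0 (n : Fin 2 → ℤ) : A (UnitAddTorus.intVec n) = e n := by
    rw [he]
    simp [hA, UnitAddTorus.intVec]
  set Φ : (Fin 2 → ℝ) → ℂ := fun x => φ (A x).1 * ψ (A x).2 with hΦ
  have hΦc : Continuous Φ := by fun_prop
  -- With w = `e' k`, the phase k · x equals w · A x, because `k` lists the pairings of w with the
  -- basis. The area-preserving change of variables and Fubini then split the integral.
  have hcoef (k : Fin 2 → ℤ) :
      ∫ x, UnitAddTorus.mFourier (-k) (UnitAddTorus.proj x) * Φ x =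
        𝓕 φ (e' k : ℝ × ℝ).1 * 𝓕 ψ (e' k : ℝ × ℝ).2 := by
    obtain ⟨h0, h1⟩ := he' k
    set w : ℝ × ℝ := (e' k : ℝ × ℝ)
    set G : ℝ × ℝ → ℂ := fun p =>
      (Complex.exp ((-2 * Real.pi * (w.1 * p.1) : ℝ) * Complex.I) * φ p.1) *
        (Complex.exp ((-2 * Real.pi * (w.2 * p.2) : ℝ) * Complex.I) * ψ p.2) with hG
    have hGc : Continuous G :=
      ((continuous_exp_mul hφc w.1).comp continuous_fst).mul
        ((continuous_exp_mul hψc w.2).comp continuous_snd)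
    have hGA (x : Fin 2 → ℝ) :
        UnitAddTorus.mFourier (-k) (UnitAddTorus.proj x) * Φ x = G (A x) := by
      simp only [UnitAddTorus.mFourier, UnitAddTorus.proj, ContinuousMap.coe_mk,
        Fin.prod_univ_two, fourier_coe_apply, hG, hΦ]
      conv_rhs => rw [mul_mul_mul_comm]
      rw [← Complex.exp_add, ← Complex.exp_add]
      congr 2
      simp only [Pi.neg_apply, Int.cast_neg, hA]
      have h0' : (k 0 : ℂ) = a * w.1 + c * w.2 := by exact_mod_cast congrArg Complex.ofReal h0
      have h1' : (k 1 : ℂ) = b * w.1 + d * w.2 := by exact_mod_cast congrArg Complex.ofReal h1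
      push_cast
      rw [h0', h1']
      ring
    simp only [hGA]
    rw [← integral_map hAmp.measurable.aemeasurable hGc.aestronglyMeasurable, hAmp.map_eq,
      Measure.volume_eq_prod, integral_prod_mul
        (fun p : ℝ => Complex.exp ((-2 * Real.pi * (w.1 * p) : ℝ) * Complex.I) * φ p)
        (fun p : ℝ => Complex.exp ((-2 * Real.pi * (w.2 * p) : ℝ) * Complex.I) * ψ p)]
    rw [Real.fourier_eq', Real.fourier_eq']
    simp only [smul_eq_mul, RCLike.inner_apply, conj_trivial]
  have hpoisson := UnitAddTorus.tsum_eq_tsum_integral hΦc ?_ ?_ ?_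
  · simp only [hcoef] at hpoisson
    rw [← e.tsum_eq, ← e'.tsum_eq, ← hpoisson]
    simp only [hΦ, hA0]
  · exact (hAmp.integrable_comp ((hφc.comp continuous_fst).mul
      (hψc.comp continuous_snd)).aestronglyMeasurable).2
        ((hφ.integrable hφc).mul_prod (hψ.integrable hψc))
  · intro R
    obtain ⟨S, hS⟩ := (isCompact_closedBall (0 : Fin 2 → ℝ) R).exists_bound_of_continuousOn
      hAc.continuousOn
    obtain ⟨C, hC0, hC⟩ := hφ.exists_mul_le hψ
    refine ⟨fun n => C * ((1 + S) ^ 3 * cubicDecay ‖(e n : ℝ × ℝ)‖), ?_, fun x hx n => ?_⟩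
    · exact ((e.summable_iff.2 (summable_cubicDecay 𝓛)).mul_left _).mul_left _
    · rw [hΦ]
      simp only
      rw [hAe]
      refine (hC _).trans (mul_le_mul_of_nonneg_left (cubicDecay_norm_add_le _ _ ?_) hC0)
      exact hS x (by simpa using hx)
  · simp only [hcoef]
    exact e'.summable_iff.2 hs

end Lattice

end FourierEigenmeasure

namespace FourierEigenmeasure

/-! ### A Bessel inequality for exponentials with frequencies in a lattice -/

/-- The character `t ↦ exp (2πixt)`. -/
noncomputable def character (x t : ℝ) : ℂ := Complex.exp ((2 * Real.pi * (x * t) : ℝ) * Complex.I)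

theorem continuous_character (x : ℝ) : Continuous (character x) := by
  unfold character; fun_prop

theorem norm_character (x t : ℝ) : ‖character x t‖ = 1 := Complex.norm_exp_ofReal_mul_I _

theorem character_mul_conj (x y t : ℝ) :
    character x t * conj (character y t) = character (x - y) t := by
  unfold character
  rw [← Complex.exp_conj, ← Complex.exp_add]
  congr 1
  simp only [map_mul, Complex.conj_ofReal, Complex.conj_I]
  push_cast
  ring

theorem fourierInv_eq_integral_character (f : ℝ → ℂ) (x : ℝ) :
    𝓕⁻ f x = ∫ t, character x t * f t := by
  rw [Real.fourierInv_eq']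
  simp only [smul_eq_mul, RCLike.inner_apply, conj_trivial, character]

theorem integrable_gaussian : Integrable fun t : ℝ => Real.exp (-Real.pi * t ^ 2) :=
  integrable_exp_neg_mul_sq Real.pi_pos

theorem integral_character_mul_gaussian (x : ℝ) :
    ∫ t, character x t * (Real.exp (-Real.pi * t ^ 2) : ℂ) = (Real.exp (-Real.pi * x ^ 2) : ℂ) := by
  rw [← fourierInv_eq_integral_character, Real.fourierInv_eq_fourier_neg]
  have h := congrFun (fourier_gaussian_pi (b := 1) (by simp)) (-x)
  simp only [mul_one, Complex.one_cpow, div_one, one_mul] at h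
  push_cast at h ⊢
  rw [h]
  simp

/-- Squaring (1 + |t|)² ≤ 2(1 + t²) ≤ 2exp(t²) gives 4exp(2t²), and 2 ≤ π. -/
theorem exp_neg_pi_sq_le (t : ℝ) : Real.exp (-Real.pi * t ^ 2) ≤ 4 * cubicDecay |t| := by
  have h1 : (1 + |t|) ^ 2 ≤ 2 * Real.exp (t ^ 2) := by
    nlinarith [Real.add_one_le_exp (t ^ 2), sq_nonneg (1 - |t|), sq_abs t]
  have h2 : (1 + |t|) ^ 3 ≤ 4 * Real.exp (Real.pi * t ^ 2) := by
    calc (1 + |t|) ^ 3 ≤ (1 + |t|) ^ 4 :=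
          pow_le_pow_right₀ (by linarith [abs_nonneg t]) (by norm_num)
      _ = ((1 + |t|) ^ 2) ^ 2 := by ring
      _ ≤ (2 * Real.exp (t ^ 2)) ^ 2 := by gcongr
      _ = 4 * Real.exp (2 * t ^ 2) := by
        rw [mul_pow, ← Real.exp_nat_mul]; norm_num
      _ ≤ _ := by
        gcongr
        exact Real.two_le_pi
  rw [neg_mul, Real.exp_neg, cubicDecay, ← div_eq_mul_inv, inv_eq_one_div,
    div_le_div_iff₀ (Real.exp_pos _) (by positivity)]
  linarith

/-- The Gaussian is its own Fourier transform, so expanding the square produces Gaussians of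
frequency differences. -/
theorem integral_gaussian_mul_sq_le {ι : Type*} (s : Finset ι) (c : ι → ℂ) (x : ι → ℝ) :
    ∫ t, Real.exp (-Real.pi * t ^ 2) * ‖∑ i ∈ s, c i * character (x i) t‖ ^ 2 ≤
      ∑ i ∈ s, ∑ j ∈ s, ‖c i‖ * ‖c j‖ * Real.exp (-Real.pi * (x i - x j) ^ 2) := by
  have hint (i j : ι) : Integrable fun t : ℝ =>
      c i * conj (c j) * (character (x i - x j) t * (Real.exp (-Real.pi * t ^ 2) : ℂ)) := by
    refine (Integrable.bdd_mul integrable_gaussian.ofReal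
      (continuous_character _).aestronglyMeasurable (c := 1) ?_).const_mul _
    exact Filter.Eventually.of_forall fun t => (norm_character _ _).le
  have h : ((∫ t, Real.exp (-Real.pi * t ^ 2) *
      ‖∑ i ∈ s, c i * character (x i) t‖ ^ 2 : ℝ) : ℂ) =
      ∑ i ∈ s, ∑ j ∈ s, c i * conj (c j) * (Real.exp (-Real.pi * (x i - x j) ^ 2) : ℂ) := by
    rw [← integral_complex_ofReal]
    have hterm (i j : ι) : c i * conj (c j) * (Real.exp (-Real.pi * (x i - x j) ^ 2) : ℂ) =
        ∫ t, c i * conj (c j) * (character (x i - x j) t * (Real.exp (-Real.pi * t ^ 2) : ℂ)) := by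
      rw [integral_const_mul, integral_character_mul_gaussian]
    rw [Finset.sum_congr rfl fun i _ => Finset.sum_congr rfl fun j _ => hterm i j]
    simp_rw [← integral_finsetSum s fun j _ => hint _ j]
    rw [← integral_finsetSum s fun i _ => integrable_finsetSum s fun j _ => hint i j]
    congr 1 with t
    rw [Complex.ofReal_mul, Complex.ofReal_pow, ← Complex.mul_conj', map_sum, Finset.sum_mul_sum, Finset.mul_sum]
    refine Finset.sum_congr rfl fun i _ => ?_
    rw [Finset.mul_sum]
    refine Finset.sum_congr rfl fun j _ => ?_
    rw [← character_mul_conj, map_mul]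
    ring
  have h2 := congrArg norm h
  rw [Complex.norm_real] at h2
  refine (le_abs_self _).trans (h2.trans_le ?_)
  refine (norm_sum_le _ _).trans (Finset.sum_le_sum fun i _ => ?_)
  refine (norm_sum_le _ _).trans (Finset.sum_le_sum fun j _ => ?_)
  rw [norm_mul, norm_mul, RCLike.norm_conj, Complex.norm_real, Real.norm_of_nonneg (by positivity)]

section Lattice

variable {𝓛 : Submodule ℤ (ℝ × ℝ)} [DiscreteTopology 𝓛] [IsZLattice ℝ 𝓛]

theorem sum_cubicDecay_sub_le (s : Finset 𝓛) (z : 𝓛) :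
    ∑ w ∈ s, cubicDecay ‖(z : ℝ × ℝ) - w‖ ≤ ∑' w : 𝓛, cubicDecay ‖(w : ℝ × ℝ)‖ := by
  have hs := (Equiv.subLeft z).summable_iff.2 (summable_cubicDecay 𝓛)
  rw [← (Equiv.subLeft z).tsum_eq]
  exact hs.sum_le_tsum s fun w _ => cubicDecay_nonneg (norm_nonneg _)

theorem cubicDecay_mul_sub_le (u v : ℝ) :
    cubicDecay |u| * cubicDecay |v| ≤ cubicDecay |u - v| := by
  have h := cubicDecay_mul_le (s := |u|) (t := |v|) (abs_nonneg (u - v)) one_pos (by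
    nlinarith [abs_sub u v, abs_nonneg u, abs_nonneg v])
  simpa using h

/-- Schur's test. The two internal weights give decay in z₂ - w₂ and the Gaussian gives decay in z₁
- w₁, so the kernel is at most 4 `cubicDecay ‖z - w‖`, with row and column sums at most 4`Q`. The
arithmetic-geometric mean inequality separates `a z` from `a w`. -/
theorem schur_bound (s : Finset 𝓛) (a : 𝓛 → ℂ) :
    ∑ z ∈ s, ∑ w ∈ s, ‖cubicDecay |(z : ℝ × ℝ).2| * a z‖ * ‖cubicDecay |(w : ℝ × ℝ).2| * a w‖ *
        Real.exp (-Real.pi * ((z : ℝ × ℝ).1 - (w : ℝ × ℝ).1) ^ 2) ≤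
      4 * (∑' w : 𝓛, cubicDecay ‖(w : ℝ × ℝ)‖) * ∑ z ∈ s, ‖a z‖ ^ 2 := by
  set Q := ∑' w : 𝓛, cubicDecay ‖(w : ℝ × ℝ)‖
  have hterm (z w : 𝓛) : ‖cubicDecay |(z : ℝ × ℝ).2| * a z‖ *
      ‖cubicDecay |(w : ℝ × ℝ).2| * a w‖ *
        Real.exp (-Real.pi * ((z : ℝ × ℝ).1 - (w : ℝ × ℝ).1) ^ 2) ≤
      2 * (‖a z‖ ^ 2 * cubicDecay ‖(z : ℝ × ℝ) - w‖) +
        2 * (‖a w‖ ^ 2 * cubicDecay ‖(z : ℝ × ℝ) - w‖) := by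
    have hz := cubicDecay_nonneg (abs_nonneg (z : ℝ × ℝ).2)
    have hw := cubicDecay_nonneg (abs_nonneg (w : ℝ × ℝ).2)
    rw [norm_mul, norm_mul, Complex.norm_real, Complex.norm_real, Real.norm_of_nonneg hz,
      Real.norm_of_nonneg hw]
    have h1 : cubicDecay |(z : ℝ × ℝ).2| * cubicDecay |(w : ℝ × ℝ).2| *
        Real.exp (-Real.pi * ((z : ℝ × ℝ).1 - (w : ℝ × ℝ).1) ^ 2) ≤
        4 * cubicDecay ‖(z : ℝ × ℝ) - w‖ := by
      calc _ ≤ cubicDecay |(z : ℝ × ℝ).2 - (w : ℝ × ℝ).2| *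
            (4 * cubicDecay |(z : ℝ × ℝ).1 - (w : ℝ × ℝ).1|) :=
            mul_le_mul (cubicDecay_mul_sub_le _ _) (exp_neg_pi_sq_le _) (Real.exp_pos _).le
              (cubicDecay_nonneg (abs_nonneg _))
        _ = 4 * (cubicDecay |((z : ℝ × ℝ) - w).1| * cubicDecay |((z : ℝ × ℝ) - w).2|) := by
            rw [Prod.fst_sub, Prod.snd_sub]; ring
        _ ≤ _ := by
            have := cubicDecay_mul_le_norm ((z : ℝ × ℝ) - w)
            linarith
    have h2 : ‖a z‖ * ‖a w‖ ≤ (‖a z‖ ^ 2 + ‖a w‖ ^ 2) / 2 := by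
      nlinarith [sq_nonneg (‖a z‖ - ‖a w‖)]
    have h3 := cubicDecay_nonneg (norm_nonneg ((z : ℝ × ℝ) - w))
    calc _ = (‖a z‖ * ‖a w‖) * (cubicDecay |(z : ℝ × ℝ).2| * cubicDecay |(w : ℝ × ℝ).2| *
          Real.exp (-Real.pi * ((z : ℝ × ℝ).1 - (w : ℝ × ℝ).1) ^ 2)) := by ring
      _ ≤ (‖a z‖ * ‖a w‖) * (4 * cubicDecay ‖(z : ℝ × ℝ) - w‖) := by gcongr
      _ ≤ ((‖a z‖ ^ 2 + ‖a w‖ ^ 2) / 2) * (4 * cubicDecay ‖(z : ℝ × ℝ) - w‖) := by gcongr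
      _ = _ := by ring
  have hhalf : ∑ z ∈ s, ∑ w ∈ s, ‖a z‖ ^ 2 * cubicDecay ‖(z : ℝ × ℝ) - w‖ ≤
      Q * ∑ z ∈ s, ‖a z‖ ^ 2 := by
    rw [Finset.mul_sum]
    refine Finset.sum_le_sum fun z _ => ?_
    rw [← Finset.mul_sum, mul_comm]
    exact mul_le_mul_of_nonneg_right (sum_cubicDecay_sub_le s z) (by positivity)
  have hhalf' : ∑ z ∈ s, ∑ w ∈ s, ‖a w‖ ^ 2 * cubicDecay ‖(z : ℝ × ℝ) - w‖ ≤
      Q * ∑ z ∈ s, ‖a z‖ ^ 2 := by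
    rw [Finset.sum_comm]
    simpa only [norm_sub_rev] using hhalf
  refine (Finset.sum_le_sum fun z _ => Finset.sum_le_sum fun w _ => hterm z w).trans ?_
  simp only [Finset.sum_add_distrib, ← Finset.mul_sum] at hhalf hhalf' ⊢
  linarith

/-- The values of `f^∨` at the points of the projected lattice are square summable with weights
that decay in the internal direction. -/
theorem summable_sq_fourierInv (f : C_c(ℝ, ℂ)) :
    Summable fun z : 𝓛 =>
      ‖cubicDecay |(z : ℝ × ℝ).2| * 𝓕⁻ (f : ℝ → ℂ) (z : ℝ × ℝ).1‖ ^ 2 := by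
  set a : 𝓛 → ℂ := fun z => cubicDecay |(z : ℝ × ℝ).2| * 𝓕⁻ (f : ℝ → ℂ) (z : ℝ × ℝ).1 with ha
  set γ : ℝ → ℝ := fun t => Real.exp (-Real.pi * t ^ 2 / 2) with hγ
  have hγ2 (t : ℝ) : γ t ^ 2 = Real.exp (-Real.pi * t ^ 2) := by
    rw [hγ, ← Real.exp_nat_mul]; congr 1; push_cast; ring
  have hγc : Continuous γ := by fun_prop
  have hγ0 (t : ℝ) : 0 < γ t := Real.exp_pos _
  -- Dividing by the square root of the Gaussian costs nothing, since `f` has compact support.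
  set f₀ : ℝ → ℂ := fun t => f t * ((γ t)⁻¹ : ℝ) with hf₀
  have hf₀c : Continuous f₀ :=
    f.continuous.mul (Complex.continuous_ofReal.comp (hγc.inv₀ fun t => (hγ0 t).ne'))
  have hf₀s : HasCompactSupport f₀ := f.hasCompactSupport.mul_right
  have hf₀i : Integrable fun t => ‖f₀ t‖ ^ 2 := by
    refine Continuous.integrable_of_hasCompactSupport (by fun_prop) ?_
    exact hf₀s.comp_left (g := fun z : ℂ => ‖z‖ ^ 2) (by simp)
  -- The Schur constant, with 1 added so that it is positive and can be inverted.
  set B : ℝ := 4 * (∑' w : 𝓛, cubicDecay ‖(w : ℝ × ℝ)‖) + 1 with hB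
  have hB0 : 0 < B := by
    have : 0 ≤ ∑' w : 𝓛, cubicDecay ‖(w : ℝ × ℝ)‖ :=
      tsum_nonneg fun w => cubicDecay_nonneg (norm_nonneg _)
    positivity
  refine summable_of_sum_le (c := B * ∫ t, ‖f₀ t‖ ^ 2) (fun z => by positivity) fun s => ?_
  -- Dual coefficients, chosen so that pairing them with the values of f^∨ gives ∑ |a z|² = `N`.
  set c : 𝓛 → ℂ := fun z => cubicDecay |(z : ℝ × ℝ).2| * conj (a z) with hc
  set P : ℝ → ℂ := fun t => ∑ z ∈ s, c z * character (z : ℝ × ℝ).1 t with hP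
  set N : ℝ := ∑ z ∈ s, ‖a z‖ ^ 2 with hN
  have hPc : Continuous P :=
    continuous_finsetSum _ fun z _ => continuous_const.mul (continuous_character _)
  have hfi : Integrable f := f.continuous.integrable_of_hasCompactSupport f.hasCompactSupport
  have hci (z : 𝓛) : Integrable fun t => c z * (character (z : ℝ × ℝ).1 t * f t) := by
    refine (hfi.bdd_mul (continuous_character _).aestronglyMeasurable (c := 1) ?_).const_mul _
    exact Filter.Eventually.of_forall fun t => (norm_character _ _).le
  have hNint : (N : ℂ) = ∫ t, f₀ t * (γ t * P t) := by
    have h1 : (N : ℂ) = ∑ z ∈ s, c z * 𝓕⁻ (f : ℝ → ℂ) (z : ℝ × ℝ).1 := by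
      rw [hN]
      push_cast
      refine Finset.sum_congr rfl fun z _ => ?_
      rw [← Complex.conj_mul', hc]
      simp only [ha]
      ring
    rw [h1]
    simp_rw [fourierInv_eq_integral_character, ← integral_const_mul]
    rw [← integral_finsetSum s fun z _ => hci z]
    congr 1 with t
    have : (γ t : ℂ) ≠ 0 := by exact_mod_cast (hγ0 t).ne'
    simp only [hf₀, hP, Complex.ofReal_inv, Finset.mul_sum]
    refine Finset.sum_congr rfl fun z _ => ?_
    field_simp
  have hG : Integrable fun t => Real.exp (-Real.pi * t ^ 2) * ‖P t‖ ^ 2 := by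
    refine integrable_gaussian.mul_bdd (c := (∑ z ∈ s, ‖c z‖) ^ 2)
      (by fun_prop : Continuous fun t => ‖P t‖ ^ 2).aestronglyMeasurable
      (Filter.Eventually.of_forall fun t => ?_)
    rw [norm_pow, norm_norm]
    gcongr
    refine (norm_sum_le _ _).trans (Finset.sum_le_sum fun z _ => ?_)
    rw [norm_mul, norm_character, mul_one]
  have hGle : ∫ t, Real.exp (-Real.pi * t ^ 2) * ‖P t‖ ^ 2 ≤ B * N := by
    refine (integral_gaussian_mul_sq_le s c fun z => (z : ℝ × ℝ).1).trans ?_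
    have := schur_bound s fun z => conj (a z)
    simp only [RCLike.norm_conj] at this
    refine this.trans (mul_le_mul_of_nonneg_right (by linarith) ?_)
    exact Finset.sum_nonneg fun z _ => by positivity
  -- Young's inequality, weighted so that the second term integrates to at most `N / 2` and is
  -- absorbed; this leaves a bound on `N` independent of `s`.
  have hpt (t : ℝ) : ‖f₀ t * (γ t * P t)‖ ≤
      B / 2 * ‖f₀ t‖ ^ 2 + (2 * B)⁻¹ * (Real.exp (-Real.pi * t ^ 2) * ‖P t‖ ^ 2) := by
    rw [norm_mul (f₀ t), norm_mul (γ t : ℂ), Complex.norm_real, Real.norm_of_nonneg (hγ0 t).le, ← hγ2, ← mul_pow]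
    set u := ‖f₀ t‖
    set v := γ t * ‖P t‖
    have : B / 2 * u ^ 2 + (2 * B)⁻¹ * v ^ 2 - u * v = (2 * B)⁻¹ * (B * u - v) ^ 2 := by
      field_simp
      ring
    have h2 : 0 ≤ (2 * B)⁻¹ * (B * u - v) ^ 2 := by positivity
    linarith
  have hfin : N ≤ B / 2 * (∫ t, ‖f₀ t‖ ^ 2) + (2 * B)⁻¹ * (B * N) := by
    have h1 : ‖(N : ℂ)‖ ≤ ∫ t, (B / 2 * ‖f₀ t‖ ^ 2 +
        (2 * B)⁻¹ * (Real.exp (-Real.pi * t ^ 2) * ‖P t‖ ^ 2)) := by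
      rw [hNint]
      exact norm_integral_le_of_norm_le ((hf₀i.const_mul _).add (hG.const_mul _))
        (Filter.Eventually.of_forall hpt)
    rw [integral_add (hf₀i.const_mul _) (hG.const_mul _), integral_const_mul,
      integral_const_mul, Complex.norm_real] at h1
    refine (le_abs_self N).trans (h1.trans ?_)
    gcongr
  have : (2 * B)⁻¹ * (B * N) = N / 2 := by field_simp
  linarith

/-- The Bessel inequality has the squared weight, so decay of order 6 of `g` is what is needed. -/
theorem summable_mul_sq_fourierInv (g : 𝓢(ℝ, ℂ)) (f : C_c(ℝ, ℂ)) :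
    Summable fun z : 𝓛 =>
      ‖g (z : ℝ × ℝ).2‖ * ‖𝓕⁻ (f : ℝ → ℂ) (z : ℝ × ℝ).1‖ ^ 2 := by
  have h := SchwartzMap.one_add_le_sup_seminorm_apply (𝕜 := ℂ) (m := (6, 0)) le_rfl le_rfl g
  set C := 2 ^ 6 * ((Finset.Iic ((6, 0) : ℕ × ℕ)).sup fun m => SchwartzMap.seminorm ℂ m.1 m.2) g
  refine Summable.of_nonneg_of_le (fun z => by positivity) (fun z => ?_)
    ((summable_sq_fourierInv (𝓛 := 𝓛) f).mul_left C)
  have h1 := h (z : ℝ × ℝ).2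
  rw [norm_iteratedFDeriv_zero, Real.norm_eq_abs] at h1
  have h2 : ‖g (z : ℝ × ℝ).2‖ ≤ C * cubicDecay |(z : ℝ × ℝ).2| ^ 2 := by
    rw [cubicDecay, inv_pow, ← pow_mul, ← div_eq_mul_inv, le_div_iff₀ (by positivity), mul_comm]
    exact h1
  rw [norm_mul, mul_pow, Complex.norm_real, Real.norm_of_nonneg (cubicDecay_nonneg (abs_nonneg _)),
    ← mul_assoc]
  gcongr

end Lattice

end FourierEigenmeasure

namespace FourierEigenmeasure

/-! ### Eigenfunctions of the Fourier transform on `𝓢(ℝ, ℂ)` -/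

/-- Fourier inversion gives g = λ𝓕⁻g, and 𝓕⁻g(x) = 𝓕g(-x) = λg(-x). -/
theorem eigenfunction_apply {g : 𝓢(ℝ, ℂ)} {lam : ℂ} (hlam : 𝓕 g = lam • g) (x : ℝ) :
    g x = lam ^ 2 * g (-x) := by
  have h1 : g = lam • 𝓕⁻ g := by
    rw [← FourierTransform.fourierInv_smul, ← hlam, FourierTransform.fourierInv_fourier_eq]
  have h2 : 𝓕⁻ g x = 𝓕 g (-x) := by
    rw [SchwartzMap.fourierInv_coe, SchwartzMap.fourier_coe, Real.fourierInv_eq_fourier_neg]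
  calc g x = (lam • 𝓕⁻ g) x := by rw [← h1]
    _ = lam * 𝓕 g (-x) := by rw [smul_apply, h2, smul_eq_mul]
    _ = _ := by rw [hlam, smul_apply, smul_eq_mul]; ring

theorem eigenvalue_pow_four {g : 𝓢(ℝ, ℂ)} (hg : g ≠ 0) {lam : ℂ} (hlam : 𝓕 g = lam • g) :
    lam ^ 4 = 1 := by
  obtain ⟨x, hx⟩ : ∃ x, g x ≠ 0 := by
    by_contra! h
    exact hg (SchwartzMap.ext h)
  have h := eigenfunction_apply hlam x
  rw [eigenfunction_apply hlam (-x), neg_neg, ← mul_assoc] at h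
  have := mul_right_cancel₀ hx ((one_mul (g x)).trans h)
  rw [this]; ring

theorem mem_of_pow_four_eq_one {lam : ℂ} (h : lam ^ 4 = 1) :
    lam ∈ ({1, Complex.I, -1, -Complex.I} : Set ℂ) := by
  have h1 : (lam - 1) * (lam - Complex.I) * (lam + 1) * (lam + Complex.I) = 0 := by
    linear_combination h - (lam ^ 2 - 1) * Complex.I_sq
  simp only [mul_eq_zero, sub_eq_zero, add_eq_zero_iff_eq_neg, or_assoc] at h1
  simpa using h1

theorem conj_eq_pow_three {lam : ℂ} (h : lam ^ 4 = 1) : conj lam = lam ^ 3 := by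
  have h0 : lam ≠ 0 := by rintro rfl; norm_num at h
  have hn : ‖lam‖ = 1 := Complex.norm_eq_one_of_pow_eq_one h (by norm_num)
  have h1 : conj lam * lam = 1 := by rw [Complex.conj_mul', hn]; norm_num
  refine mul_right_cancel₀ h0 (h1.trans ?_)
  rw [← h]; ring

theorem norm_eq_one_of_pow_four {lam : ℂ} (h : lam ^ 4 = 1) : ‖lam‖ = 1 :=
  Complex.norm_eq_one_of_pow_eq_one h (by norm_num)

/-! ### The weighted Dirac comb as a sum over the lattice -/

/-- The indicator of `K` dominates all test functions supported in `K` at once, giving the Radon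
bound and finiteness on compact sets. -/
theorem HasCubicDecay.of_compact {K : Set ℝ} (hK : IsCompact K) :
    HasCubicDecay (K.indicator fun _ => (1 : ℂ)) := by
  obtain ⟨R, hR⟩ := hK.isBounded.exists_norm_le
  refine ⟨(1 + |R|) ^ 3, fun x => ?_⟩
  by_cases hx : x ∈ K
  · rw [Set.indicator_of_mem hx, norm_one, cubicDecay, ← div_eq_mul_inv, one_le_div (by positivity)]
    exact pow_le_pow_left₀ (by positivity) (by simpa using (hR x hx).trans (le_abs_self R)) 3
  · rw [Set.indicator_of_notMem hx, norm_zero]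
    exact mul_nonneg (by positivity) (cubicDecay_nonneg (abs_nonneg _))

variable {𝓛 : Submodule ℤ (ℝ × ℝ)}

theorem starMap_fst (hinj : Set.InjOn Prod.fst (𝓛 : Set (ℝ × ℝ))) (z : 𝓛) :
    starMap 𝓛 (z : ℝ × ℝ).1 = (z : ℝ × ℝ).2 := by
  have h : ∃ a ∈ (𝓛 : Set (ℝ × ℝ)), a.1 = (z : ℝ × ℝ).1 := ⟨z, z.2, rfl⟩
  rw [starMap, hinj (Function.invFunOn_mem h) z.2 (Function.invFunOn_eq h)]

/-- The lattice is in bijection with its projection to physical space. -/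
noncomputable def latticeEquiv (hinj : Set.InjOn Prod.fst (𝓛 : Set (ℝ × ℝ))) : 𝓛 ≃ projL 𝓛 :=
  Equiv.Set.imageOfInjOn Prod.fst (𝓛 : Set (ℝ × ℝ)) hinj

theorem latticeEquiv_coe (hinj : Set.InjOn Prod.fst (𝓛 : Set (ℝ × ℝ))) (z : 𝓛) :
    (latticeEquiv hinj z : ℝ) = (z : ℝ × ℝ).1 := rfl

theorem weightedComb_eq (hinj : Set.InjOn Prod.fst (𝓛 : Set (ℝ × ℝ))) (g : 𝓢(ℝ, ℂ))
    (φ : C_c(ℝ, ℂ)) :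
    weightedComb 𝓛 g φ = ∑' z : 𝓛, φ (z : ℝ × ℝ).1 * g (z : ℝ × ℝ).2 := by
  rw [weightedComb, ← (latticeEquiv hinj).tsum_eq]
  simp only [latticeEquiv_coe, starMap_fst hinj, mul_comm]

section Lattice

variable [DiscreteTopology 𝓛] [IsZLattice ℝ 𝓛]

theorem summable_comb (g : 𝓢(ℝ, ℂ)) (φ : C_c(ℝ, ℂ)) :
    Summable fun z : 𝓛 => φ (z : ℝ × ℝ).1 * g (z : ℝ × ℝ).2 :=
  (HasCubicDecay.of_compactlySupported φ).summable_mul (.of_schwartz g)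

theorem summable_weightedComb (hinj : Set.InjOn Prod.fst (𝓛 : Set (ℝ × ℝ))) (g : 𝓢(ℝ, ℂ))
    (φ : C_c(ℝ, ℂ)) :
    Summable fun x : projL 𝓛 => g (starMap 𝓛 x) * φ x := by
  rw [← (latticeEquiv hinj).summable_iff]
  have := summable_comb (𝓛 := 𝓛) g φ
  simpa only [Function.comp_def, latticeEquiv_coe, starMap_fst hinj, mul_comm] using this

theorem isRadonMeasure_weightedComb (hinj : Set.InjOn Prod.fst (𝓛 : Set (ℝ × ℝ)))
    (g : 𝓢(ℝ, ℂ)) : IsRadonMeasure (weightedComb 𝓛 g) where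
  isLinearMap :=
    { map_add := fun φ ψ => by
        simp only [weightedComb_eq hinj]
        rw [← (summable_comb g φ).tsum_add (summable_comb g ψ)]
        simp only [CompactlySupportedContinuousMap.add_apply, add_mul]
      map_smul := fun c φ => by
        simp only [weightedComb_eq hinj]
        rw [smul_eq_mul, ← tsum_mul_left]
        simp only [CompactlySupportedContinuousMap.smul_apply, smul_eq_mul, mul_assoc] }
  bounded K hK := by
    have hs := ((HasCubicDecay.of_compact hK).summable_mul (𝓛 := 𝓛) (.of_schwartz g)).norm
    refine ⟨∑' z : 𝓛, ‖K.indicator (fun _ => (1 : ℂ)) (z : ℝ × ℝ).1 * g (z : ℝ × ℝ).2‖,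
      fun φ hφ M hM => ?_⟩
    rw [weightedComb_eq hinj]
    refine tsum_of_norm_bounded (hs.hasSum.mul_right M) fun z => ?_
    rw [norm_mul, norm_mul, mul_right_comm]
    gcongr
    by_cases hz : (z : ℝ × ℝ).1 ∈ K
    · rw [Set.indicator_of_mem hz, norm_one, one_mul]
      exact hM _
    · rw [image_eq_zero_of_notMem_tsupport fun h => hz (hφ h), Set.indicator_of_notMem hz]
      simp

/-! ### The comb as a tempered distribution -/

/-- The tempered distribution `∑ g(z₂) δ_{z₁}`, the sum being over the lattice. -/
noncomputable def combDistribution (𝓛 : Submodule ℤ (ℝ × ℝ)) [DiscreteTopology 𝓛] [IsZLattice ℝ 𝓛]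
    (g : 𝓢(ℝ, ℂ)) : 𝓢'(ℝ, ℂ) :=
  ContinuousLinearMap.toPointwiseConvergenceCLM _ _ _ _ <|
    SchwartzMap.mkCLMtoNormedSpace (𝕜 := ℂ) (σ := RingHom.id ℂ)
      (fun f : 𝓢(ℝ, ℂ) => ∑' z : 𝓛, f (z : ℝ × ℝ).1 * g (z : ℝ × ℝ).2)
      (fun f h => by
        rw [← ((HasCubicDecay.of_schwartz f).summable_mul (.of_schwartz g)).tsum_add
          ((HasCubicDecay.of_schwartz h).summable_mul (.of_schwartz g))]
        simp only [add_apply, add_mul])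
      (fun c f => by
        rw [RingHom.id_apply, smul_eq_mul, ← tsum_mul_left]
        simp only [smul_apply, smul_eq_mul, mul_assoc])
      (by
        obtain ⟨s, C, hC0, hC⟩ := exists_seminorm_cubicDecay
        obtain ⟨D, hD⟩ := HasCubicDecay.of_schwartz g
        have hD0 : 0 ≤ D := by simpa [cubicDecay] using (norm_nonneg _).trans (hD 0)
        refine ⟨s, C * D * ∑' z : 𝓛, cubicDecay ‖(z : ℝ × ℝ)‖, ?_, fun f => ?_⟩
        · exact mul_nonneg (mul_nonneg hC0 hD0)
            (tsum_nonneg fun z => cubicDecay_nonneg (norm_nonneg _))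
        · have hS : 0 ≤ C * (s.sup (schwartzSeminormFamily ℂ ℝ ℂ)) f :=
            mul_nonneg hC0 (apply_nonneg _ _)
          refine (tsum_of_norm_bounded ((summable_cubicDecay 𝓛).hasSum.mul_left
            (C * (s.sup (schwartzSeminormFamily ℂ ℝ ℂ)) f * D)) fun z => ?_).trans_eq (by ring)
          rw [norm_mul]
          calc ‖f (z : ℝ × ℝ).1‖ * ‖g (z : ℝ × ℝ).2‖
              ≤ (C * (s.sup (schwartzSeminormFamily ℂ ℝ ℂ)) f * cubicDecay |(z : ℝ × ℝ).1|) *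
                (D * cubicDecay |(z : ℝ × ℝ).2|) :=
                mul_le_mul (hC f _) (hD _) (norm_nonneg _)
                  (mul_nonneg hS (cubicDecay_nonneg (abs_nonneg _)))
            _ = C * (s.sup (schwartzSeminormFamily ℂ ℝ ℂ)) f * D *
                (cubicDecay |(z : ℝ × ℝ).1| * cubicDecay |(z : ℝ × ℝ).2|) := by ring
            _ ≤ _ := mul_le_mul_of_nonneg_left (cubicDecay_mul_le_norm _) (mul_nonneg hS hD0))

theorem combDistribution_apply (g f : 𝓢(ℝ, ℂ)) :
    combDistribution 𝓛 g f = ∑' z : 𝓛, f (z : ℝ × ℝ).1 * g (z : ℝ × ℝ).2 := rfl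

theorem represents_combDistribution (hinj : Set.InjOn Prod.fst (𝓛 : Set (ℝ × ℝ)))
    (g : 𝓢(ℝ, ℂ)) : Represents (combDistribution 𝓛 g) (weightedComb 𝓛 g) := by
  intro f φ h
  rw [combDistribution_apply, weightedComb_eq hinj]
  simp only [h]

/-- Poisson summation turns the sum of f·g into λ times the sum of f̂·g, and the conjugate of λ
cancels λ. -/
theorem fourier_combDistribution (hdual : dualLattice 𝓛 = (𝓛 : Set (ℝ × ℝ)))
    {g : 𝓢(ℝ, ℂ)} {lam : ℂ} (h4 : lam ^ 4 = 1) (hlam : 𝓕 g = lam • g) :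
    𝓕 (combDistribution 𝓛 g) = conj lam • combDistribution 𝓛 g := by
  ext f
  change combDistribution 𝓛 g (𝓕 f) = conj lam * combDistribution 𝓛 g f
  have hg (y : ℝ) : 𝓕 (g : ℝ → ℂ) y = lam * g y := by
    rw [← SchwartzMap.fourier_coe, hlam, smul_apply, smul_eq_mul]
  have hs := (HasCubicDecay.of_schwartz (𝓕 f)).summable_mul (𝓛 := 𝓛) (.of_schwartz (𝓕 g))
  rw [SchwartzMap.fourier_coe, SchwartzMap.fourier_coe] at hs
  rw [combDistribution_apply, combDistribution_apply, SchwartzMap.fourier_coe,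
    tsum_lattice_eq_tsum_fourier hdual (.of_schwartz f) (.of_schwartz g) f.continuous
      g.continuous hs, ← tsum_mul_left]
  refine tsum_congr fun z => ?_
  rw [hg, conj_eq_pow_three h4]
  linear_combination -(𝓕 (f : ℝ → ℂ) (z : ℝ × ℝ).1 * g (z : ℝ × ℝ).2) * h4

theorem IsRadonMeasure.smul {μ : C_c(ℝ, ℂ) → ℂ} (hμ : IsRadonMeasure μ) (c : ℂ) :
    IsRadonMeasure (c • μ) where
  isLinearMap :=
    { map_add := fun φ ψ => by simp [hμ.isLinearMap.map_add, mul_add]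
      map_smul := fun a φ => by simp [hμ.isLinearMap.map_smul, mul_left_comm] }
  bounded K hK := by
    obtain ⟨C, hC⟩ := hμ.bounded K hK
    refine ⟨‖c‖ * C, fun φ hφ M hM => ?_⟩
    rw [Pi.smul_apply, norm_smul, mul_assoc]
    exact mul_le_mul_of_nonneg_left (hC φ hφ M hM) (norm_nonneg _)

/-! ### Non-vanishing of the comb -/

/-- The tent function `x ↦ max 0 (1 - (n + 1)|x - p|)`. -/
noncomputable def tent (p : ℝ) (n : ℕ) : C_c(ℝ, ℂ) where
  toFun x := ((max 0 (1 - (n + 1) * |x - p|) : ℝ) : ℂ)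
  continuous_toFun := by fun_prop
  hasCompactSupport' := by
    refine HasCompactSupport.intro (isCompact_closedBall p 1) fun x hx => ?_
    rw [Metric.mem_closedBall, Real.dist_eq, not_le] at hx
    have : (1 : ℝ) ≤ (n + 1) * |x - p| := by
      nlinarith [(Nat.cast_nonneg n : (0 : ℝ) ≤ n)]
    rw [max_eq_left (by linarith), Complex.ofReal_zero]

theorem tent_apply (p : ℝ) (n : ℕ) (x : ℝ) :
    tent p n x = ((max 0 (1 - (n + 1) * |x - p|) : ℝ) : ℂ) := rfl

theorem norm_tent_le (p : ℝ) (n : ℕ) (x : ℝ) : ‖tent p n x‖ ≤ ‖tent p 0 x‖ := by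
  rw [tent_apply, tent_apply, Complex.norm_real, Complex.norm_real,
    Real.norm_of_nonneg (le_max_left _ _), Real.norm_of_nonneg (le_max_left _ _)]
  refine max_le_max le_rfl ?_
  have : 0 ≤ (n : ℝ) * |x - p| := by positivity
  push_cast
  linarith

theorem tendsto_tent (p x : ℝ) :
    Filter.Tendsto (fun n => tent p n x) Filter.atTop (nhds (if x = p then 1 else 0)) := by
  split_ifs with h
  · simp [tent_apply, h]
  · have hp : 0 < |x - p| := abs_pos.2 (sub_ne_zero.2 h)
    obtain ⟨N, hN⟩ := exists_nat_gt (1 / |x - p|)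
    rw [div_lt_iff₀ hp] at hN
    refine tendsto_const_nhds.congr' ?_
    filter_upwards [Filter.eventually_ge_atTop N] with n hn
    have : (N : ℝ) ≤ n := by exact_mod_cast hn
    rw [tent_apply, max_eq_left (by nlinarith), Complex.ofReal_zero]

/-- Dominated convergence, with the widest tent as majorant; injectivity of the projection leaves
only the term at `w`. -/
theorem tendsto_weightedComb_tent (hinj : Set.InjOn Prod.fst (𝓛 : Set (ℝ × ℝ)))
    (g : 𝓢(ℝ, ℂ)) (w : 𝓛) :
    Filter.Tendsto (fun n => weightedComb 𝓛 g (tent (w : ℝ × ℝ).1 n)) Filter.atTop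
      (nhds (g (w : ℝ × ℝ).2)) := by
  classical
  simp only [weightedComb_eq hinj]
  have h := tendsto_tsum_of_dominated_convergence (f := fun n (z : 𝓛) => tent (w : ℝ × ℝ).1 n (z : ℝ × ℝ).1 * g (z : ℝ × ℝ).2)
    (summable_comb (𝓛 := 𝓛) g (tent (w : ℝ × ℝ).1 0)).norm
    (fun z => (tendsto_tent (w : ℝ × ℝ).1 (z : ℝ × ℝ).1).mul_const (g (z : ℝ × ℝ).2))
    (Filter.Eventually.of_forall fun n z => by
      rw [norm_mul, norm_mul]
      gcongr
      exact norm_tent_le _ _ _)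
  rw [tsum_eq_single w] at h
  · simpa using h
  · intro z hz
    rw [if_neg fun h => hz (Subtype.ext (hinj z.2 w.2 h)), zero_mul]

theorem weightedComb_ne_zero (hinj : Set.InjOn Prod.fst (𝓛 : Set (ℝ × ℝ)))
    (hdense : Dense (Prod.snd '' (𝓛 : Set (ℝ × ℝ)))) {g : 𝓢(ℝ, ℂ)} (hg : g ≠ 0) :
    weightedComb 𝓛 g ≠ 0 := by
  intro h0
  refine hg (SchwartzMap.ext fun x => ?_)
  refine congrFun (Continuous.ext_on hdense g.continuous continuous_const
    (g := fun _ => (0 : ℂ)) ?_) x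
  rintro - ⟨z, hz, rfl⟩
  have h := tendsto_weightedComb_tent hinj g ⟨z, hz⟩
  rw [h0] at h
  exact tendsto_nhds_unique h tendsto_const_nhds

theorem isEigenmeasure_weightedComb (hinj : Set.InjOn Prod.fst (𝓛 : Set (ℝ × ℝ)))
    (hdense : Dense (Prod.snd '' (𝓛 : Set (ℝ × ℝ))))
    (hdual : dualLattice 𝓛 = (𝓛 : Set (ℝ × ℝ))) {g : 𝓢(ℝ, ℂ)} (hg : g ≠ 0) {lam : ℂ}
    (hlam : 𝓕 g = lam • g) : IsEigenmeasure (weightedComb 𝓛 g) (conj lam) := by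
  have hR := isRadonMeasure_weightedComb hinj g
  have hT := represents_combDistribution hinj g
  refine ⟨⟨hR, _, hT⟩, weightedComb_ne_zero hinj hdense hg, hR, hR.smul _, _, hT, ?_⟩
  rw [fourier_combDistribution hdual (eigenvalue_pow_four hg hlam) hlam]
  intro f φ h
  rw [Pi.smul_apply, ← hT f φ h]
  rfl

end Lattice

/-! ### The strict Fourier transform -/

/-- The total variation of the weighted Dirac comb. -/
noncomputable def combVariation (𝓛 : Submodule ℤ (ℝ × ℝ)) (g : 𝓢(ℝ, ℂ)) : Measure ℝ :=
  Measure.sum fun z : 𝓛 => ENNReal.ofReal ‖g (z : ℝ × ℝ).2‖ • Measure.dirac (z : ℝ × ℝ).1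

/-- The density of `c • ω_g` with respect to its total variation, for a unimodular `c`. -/
noncomputable def combDensity (𝓛 : Submodule ℤ (ℝ × ℝ)) (g : 𝓢(ℝ, ℂ)) (c : ℂ) (x : ℝ) : ℂ :=
  open Classical in
  if x ∈ projL 𝓛 ∧ g (starMap 𝓛 x) ≠ 0 then c * (g (starMap 𝓛 x) / ‖g (starMap 𝓛 x)‖) else 1

theorem norm_combDensity (g : 𝓢(ℝ, ℂ)) {c : ℂ} (hc : ‖c‖ = 1) (x : ℝ) :
    ‖combDensity 𝓛 g c x‖ = 1 := by
  unfold combDensity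
  split_ifs with h
  · rw [norm_mul, hc, norm_div, Complex.norm_real, norm_norm, div_self (norm_ne_zero_iff.2 h.2),
      one_mul]
  · exact norm_one

/-- Where `g` vanishes both sides are 0, so the default value 1 of the density does no harm. -/
theorem norm_smul_combDensity (hinj : Set.InjOn Prod.fst (𝓛 : Set (ℝ × ℝ))) (g : 𝓢(ℝ, ℂ)) (c : ℂ)
    (z : 𝓛) :
    ‖g (z : ℝ × ℝ).2‖ * combDensity 𝓛 g c (z : ℝ × ℝ).1 = c * g (z : ℝ × ℝ).2 := by
  have hz : (z : ℝ × ℝ).1 ∈ projL 𝓛 := ⟨z, z.2, rfl⟩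
  rw [combDensity, starMap_fst hinj]
  split_ifs with h
  · have : (‖g (z : ℝ × ℝ).2‖ : ℂ) ≠ 0 := by exact_mod_cast norm_ne_zero_iff.2 h.2
    field_simp
  · have : g (z : ℝ × ℝ).2 = 0 := by
      by_contra h'
      exact h ⟨hz, h'⟩
    simp [this]

section Lattice

variable [DiscreteTopology 𝓛] [IsZLattice ℝ 𝓛]

theorem countable_lattice : Countable 𝓛 := by
  have : Module.Finite ℤ 𝓛 := ZLattice.module_finite ℝ 𝓛
  have : Module.Free ℤ 𝓛 := ZLattice.module_free ℝ 𝓛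
  exact (Module.finBasis ℤ 𝓛).equivFun.toEquiv.countable_iff.2 inferInstance

/-- The density differs from the constant 1 only on the countable set `projL 𝓛`. -/
theorem measurable_combDensity (g : 𝓢(ℝ, ℂ)) (c : ℂ) : Measurable (combDensity 𝓛 g c) := by
  have : Countable 𝓛 := countable_lattice
  refine measurable_const.measurable_of_countable_ne (f := fun _ => (1 : ℂ))
    (Set.Countable.mono (s₂ := projL 𝓛) ?_ ((Set.to_countable (𝓛 : Set (ℝ × ℝ))).image _))
  intro x hx
  by_contra h
  exact hx (if_neg fun h' => h h'.1).symm

theorem integrable_combVariation {E : Type*} [NormedAddCommGroup E] [NormedSpace ℝ E]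
    (g : 𝓢(ℝ, ℂ)) {F : ℝ → E}
    (hF : Summable fun z : 𝓛 => ‖g (z : ℝ × ℝ).2‖ * ‖F (z : ℝ × ℝ).1‖) :
    Integrable F (combVariation 𝓛 g) := by
  have : Countable 𝓛 := countable_lattice
  refine integrable_sum_measure (fun z => (integrable_dirac ?_).smul_measure ENNReal.ofReal_ne_top)
    ?_
  · exact enorm_lt_top
  · refine hF.congr fun z => ?_
    rw [integral_smul_measure, integral_dirac, ENNReal.toReal_ofReal (norm_nonneg _), smul_eq_mul]

theorem integral_combVariation {E : Type*} [NormedAddCommGroup E] [NormedSpace ℝ E]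
    [CompleteSpace E] (g : 𝓢(ℝ, ℂ)) {F : ℝ → E}
    (hF : Summable fun z : 𝓛 => ‖g (z : ℝ × ℝ).2‖ * ‖F (z : ℝ × ℝ).1‖) :
    ∫ x, F x ∂(combVariation 𝓛 g) = ∑' z : 𝓛, ‖g (z : ℝ × ℝ).2‖ • F (z : ℝ × ℝ).1 := by
  have h := integrable_combVariation g hF
  rw [combVariation] at h ⊢
  rw [integral_sum_measure h]
  refine tsum_congr fun z => ?_
  rw [integral_smul_measure, integral_dirac, ENNReal.toReal_ofReal (norm_nonneg _)]

theorem integral_mul_combDensity (hinj : Set.InjOn Prod.fst (𝓛 : Set (ℝ × ℝ))) (g : 𝓢(ℝ, ℂ))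
    {c : ℂ} (hc : ‖c‖ = 1) {F : ℝ → ℂ}
    (hF : Summable fun z : 𝓛 => ‖g (z : ℝ × ℝ).2‖ * ‖F (z : ℝ × ℝ).1‖) :
    ∫ x, F x * combDensity 𝓛 g c x ∂(combVariation 𝓛 g) =
      ∑' z : 𝓛, F (z : ℝ × ℝ).1 * (c * g (z : ℝ × ℝ).2) := by
  rw [integral_combVariation g (by simpa only [norm_mul, norm_combDensity g hc, mul_one] using hF)]
  refine tsum_congr fun z => ?_
  rw [← norm_smul_combDensity hinj, Complex.real_smul]
  ring

theorem isPolarDecomposition_weightedComb (hinj : Set.InjOn Prod.fst (𝓛 : Set (ℝ × ℝ)))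
    (g : 𝓢(ℝ, ℂ)) {c : ℂ} (hc : ‖c‖ = 1) :
    IsPolarDecomposition (c • weightedComb 𝓛 g) (combVariation 𝓛 g) (combDensity 𝓛 g c) where
  finite_on_compacts := by
    refine ⟨fun K hK => ?_⟩
    have h := integrable_combVariation (𝓛 := 𝓛) g (F := K.indicator fun _ => (1 : ℂ)) <| by
      have := ((HasCubicDecay.of_compact hK).summable_mul (𝓛 := 𝓛) (.of_schwartz g)).norm
      simpa only [norm_mul, mul_comm] using this
    rw [integrable_indicator_iff hK.measurableSet, IntegrableOn, integrable_const_iff] at h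
    simpa [isFiniteMeasure_iff] using h
  measurable_density := measurable_combDensity g c
  norm_density := norm_combDensity g hc
  apply_eq φ := by
    rw [integral_mul_combDensity hinj g hc (by
        simpa only [norm_mul, mul_comm] using (summable_comb (𝓛 := 𝓛) g φ).norm),
      Pi.smul_apply, weightedComb_eq hinj, smul_eq_mul, ← tsum_mul_left]
    exact tsum_congr fun z => by ring

end Lattice

/-- Convolution becomes a product, and the transform of f~ is the conjugate of that of f. -/
theorem fourier_conv_tilde (f : C_c(ℝ, ℂ)) (y : ℝ) :
    𝓕 (conv f (tilde f) : ℝ → ℂ) y = ((‖𝓕 (f : ℝ → ℂ) y‖ ^ 2 : ℝ) : ℂ) := by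
  have hi (h : C_c(ℝ, ℂ)) : Integrable h :=
    h.continuous.integrable_of_hasCompactSupport h.hasCompactSupport
  have h1 : 𝓕 (conv f (tilde f) : ℝ → ℂ) y = 𝓕 (f : ℝ → ℂ) y * 𝓕 (tilde f : ℝ → ℂ) y :=
    Real.fourier_mul_convolution_eq (hi f) (hi (tilde f)) y
  have h2 : 𝓕 (tilde f : ℝ → ℂ) y = conj (𝓕 (f : ℝ → ℂ) y) := by
    rw [Real.fourier_eq', Real.fourier_eq', ← integral_conj, ← integral_neg_eq_self]
    congr 1 with t
    have ht : tilde f (-t) = conj (f t) := by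
      change conj (f (- -t)) = _
      rw [neg_neg]
    simp only [smul_eq_mul, map_mul, ht, ← Complex.exp_conj, Complex.conj_ofReal, Complex.conj_I,
      RCLike.inner_apply, conj_trivial]
    congr 2
    push_cast
    ring
  rw [h1, h2, Complex.mul_conj']
  push_cast
  rfl

section Lattice

variable [DiscreteTopology 𝓛] [IsZLattice ℝ 𝓛]

/-- Poisson summation for f * f~ and g, followed by z ↦ -z, which turns 𝓕f into 𝓕⁻f. The factor
becomes λg(-z₂) = λ³g(z₂), and λ³ is the conjugate of λ. Summability of the transformed side is
supplied by the Bessel inequality. -/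
theorem weightedComb_conv_tilde (hinj : Set.InjOn Prod.fst (𝓛 : Set (ℝ × ℝ)))
    (hdual : dualLattice 𝓛 = (𝓛 : Set (ℝ × ℝ))) {g : 𝓢(ℝ, ℂ)} {lam : ℂ} (h4 : lam ^ 4 = 1)
    (hlam : 𝓕 g = lam • g) (f : C_c(ℝ, ℂ)) :
    weightedComb 𝓛 g (conv f (tilde f)) =
      ∑' z : 𝓛, ((‖𝓕⁻ (f : ℝ → ℂ) (z : ℝ × ℝ).1‖ ^ 2 : ℝ) : ℂ) *
        (conj lam * g (z : ℝ × ℝ).2) := by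
  have hterm (z : 𝓛) : 𝓕 (conv f (tilde f) : ℝ → ℂ) ((-z : 𝓛) : ℝ × ℝ).1 *
      𝓕 (g : ℝ → ℂ) ((-z : 𝓛) : ℝ × ℝ).2 =
      ((‖𝓕⁻ (f : ℝ → ℂ) (z : ℝ × ℝ).1‖ ^ 2 : ℝ) : ℂ) * (conj lam * g (z : ℝ × ℝ).2) := by
    rw [fourier_conv_tilde, ← SchwartzMap.fourier_coe, hlam, smul_apply, smul_eq_mul,
      Submodule.coe_neg, Prod.fst_neg, Prod.snd_neg, ← Real.fourierInv_eq_fourier_neg,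
      eigenfunction_apply hlam (-(z : ℝ × ℝ).2), neg_neg, conj_eq_pow_three h4]
    ring
  have hs : Summable fun z : 𝓛 => 𝓕 (conv f (tilde f) : ℝ → ℂ) (z : ℝ × ℝ).1 *
      𝓕 (g : ℝ → ℂ) (z : ℝ × ℝ).2 := by
    rw [← (Equiv.neg 𝓛).summable_iff]
    refine Summable.congr ?_ fun z => (hterm z).symm
    refine Summable.of_norm (((summable_mul_sq_fourierInv (𝓛 := 𝓛) g f).mul_left ‖conj lam‖).congr
      fun z => ?_)
    rw [norm_mul, norm_mul, Complex.norm_real, Real.norm_of_nonneg (by positivity)]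
    ring
  rw [weightedComb_eq hinj, tsum_lattice_eq_tsum_fourier hdual (.of_compactlySupported _)
    (.of_schwartz g) (conv f (tilde f)).continuous g.continuous hs, ← (Equiv.neg 𝓛).tsum_eq]
  exact tsum_congr hterm

theorem hasStrictFourierTransform_weightedComb (hinj : Set.InjOn Prod.fst (𝓛 : Set (ℝ × ℝ)))
    (hdual : dualLattice 𝓛 = (𝓛 : Set (ℝ × ℝ))) {g : 𝓢(ℝ, ℂ)} {lam : ℂ} (h4 : lam ^ 4 = 1)
    (hlam : 𝓕 g = lam • g) :
    HasStrictFourierTransform (weightedComb 𝓛 g) (conj lam • weightedComb 𝓛 g) := by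
  have hR := isRadonMeasure_weightedComb hinj g
  have hc : ‖conj lam‖ = 1 := by rw [RCLike.norm_conj, norm_eq_one_of_pow_four h4]
  refine ⟨hR, hR.smul _, _, _, isPolarDecomposition_weightedComb hinj g hc, fun f => ⟨?_, ?_⟩⟩
  · refine integrable_combVariation g ?_
    simpa only [norm_pow, norm_norm] using summable_mul_sq_fourierInv g f
  · rw [weightedComb_conv_tilde hinj hdual h4 hlam, integral_mul_combDensity hinj g hc
      (F := fun y => ((‖𝓕⁻ (f : ℝ → ℂ) y‖ ^ 2 : ℝ) : ℂ))]
    simpa only [Complex.norm_real, norm_pow, norm_norm] using summable_mul_sq_fourierInv g f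

end Lattice

end FourierEigenmeasure

/-! ### The eigenmeasure theorem -/

theorem corollary5p2 (𝓛 : Submodule ℤ (ℝ × ℝ))
    (hcps : FourierEigenmeasure.IsCutAndProjectScheme 𝓛)
    (hdual : FourierEigenmeasure.dualLattice 𝓛 = (𝓛 : Set (ℝ × ℝ)))
    (g : 𝓢(ℝ, ℂ)) (hg : g ≠ 0) (lam : ℂ) (hlam : 𝓕 g = lam • g) :
    lam ∈ ({1, Complex.I, -1, -Complex.I} : Set ℂ) ∧
    (∀ φ : C_c(ℝ, ℂ), Summable fun x : FourierEigenmeasure.projL 𝓛 =>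
      g (FourierEigenmeasure.starMap 𝓛 x) * φ x) ∧
    FourierEigenmeasure.IsEigenmeasure
      (FourierEigenmeasure.weightedComb 𝓛 g) (conj lam) ∧
    FourierEigenmeasure.IsStrictEigenmeasure
      (FourierEigenmeasure.weightedComb 𝓛 g) (conj lam) := by
  obtain ⟨hdisc, hlat, hinj, hdense⟩ := hcps
  have h4 := FourierEigenmeasure.eigenvalue_pow_four hg hlam
  have hE := FourierEigenmeasure.isEigenmeasure_weightedComb hinj hdense hdual hg hlam
  exact ⟨FourierEigenmeasure.mem_of_pow_four_eq_one h4,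
    FourierEigenmeasure.summable_weightedComb hinj g, hE, hE,
    FourierEigenmeasure.hasStrictFourierTransform_weightedComb hinj hdual h4 hlam⟩
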